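/- Let $d\ge 2$ and let $I_1,\dots,I_d$ be pairwise disjoint parallel segments of unit length in the plane. A $d$-interval is a nonempty set $J\subseteq I_1\cup\dots\cup I_d$ such that for every $i$ the component $J\cap I_i$ is a closed interval (possibly a single point, or empty). Let $\mathcal F$ be any (finite or infinite) family of $d$-intervals, and let its packing number $$\nu(\mathcal F)=\sup\{|\mathcal M| : \mathcal M\subseteq\mathcal F,\ M_1\cap M_2=\emptyset\text{ for all distinct } M_1,M_2\in\mathcal M\}$$ be the supremum of the cardinalities of its subfamilies of pairwise disjoint sets. Then $\mathcal F$ has a transversal of size at most $(d^2-d)\cdot\nu(\mathcal F)$, that is, there is a set $T\subseteq I_1\cup\dots\cup I_d$ with $|T|\le (d^2-d)\,\nu(\mathcal F)$ and $T\cap J\neq\emptyset$ for every $J\in\mathcal F$. -/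

import Mathlib

open scoped Cardinal

/-- A matching in a system `S` of sets: a subsystem of pairwise disjoint sets. -/
def IsMatchingIn {X : Type*} (S M : Set (Set X)) : Prop :=
  M ⊆ S ∧ ∀ A ∈ M, ∀ B ∈ M, A ≠ B → A ∩ B = ∅

/-- The packing number (matching number) of a system `S` of sets: the supremum of the
cardinalities of the matchings in `S`.  It is a cardinal, as `S` may be infinite; the family
of cardinals below is never empty and always bounded, so this is a genuine supremum. -/
noncomputable def packingNumber {X : Type*} (S : Set (Set X)) : Cardinal :=
  ⨆ M : {M : Set (Set X) // IsMatchingIn S M}, #M.1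

/-- A transversal, on the ground set `G`, of a system `S` of sets: a set of points of `G` that
meets every member of `S`. -/
def IsTransversal {X : Type*} (G : Set X) (S : Set (Set X)) (T : Set X) : Prop :=
  T ⊆ G ∧ ∀ A ∈ S, (A ∩ T).Nonempty

/-- The Euclidean plane. -/
abbrev Plane : Type := EuclideanSpace ℝ (Fin 2)

/-- `I₁, …, I_d` are pairwise disjoint parallel segments of unit length in the plane. -/
def AreDisjointParallelUnitSegments {d : ℕ} (I : Fin d → Set Plane) : Prop :=
  (∃ v : Plane, ‖v‖ = 1 ∧ ∀ i, ∃ p : Plane, I i = segment ℝ p (p + v)) ∧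
    ∀ i j, i ≠ j → I i ∩ I j = ∅

/-- A `d`-interval on the segments `I₁, …, I_d`: a nonempty subset of their union that meets
each of them in a closed interval.  A one-point interval (`a = b`) is allowed, and so is an
empty component. -/
def IsDInterval {d : ℕ} (I : Fin d → Set Plane) (J : Set Plane) : Prop :=
  J ⊆ ⋃ i, I i ∧ J.Nonempty ∧
    ∀ i, J ∩ I i = ∅ ∨ ∃ a b : Plane, J ∩ I i = segment ℝ a b

/-! Let the packing number be a finite n. By compactness of the space of cut positions it is enough
to pierce finite families. Cut every segment at k = (d-1)n points and suppose that each choice of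
cuts misses some member. Give each member a continuous weight, positive exactly when every component
lies strictly inside a piece. Members of positive weight are edges of a d-partite hypergraph: its
vertices are the pieces, its parts are the segments, and an edge has at most one vertex in each
part.

The cuts can be moved until the k+1 pieces of any one segment carry equal weights
(`exists_equalized_weights`). Dividing by the largest of these d common values gives a fractional
matching of total at least k+1. Füredi's bound (`exists_matching_of_isFractionalMatching`) turns it
into a matching M with k+1 ≤ (d-1)|M|, so |M| > n. Edges without common vertices come from disjoint
d-intervals, a contradiction. So some d(d-1)n cuts meet every member.

The equalization rests on Brouwer's theorem, derived here from a Scarf-type parity lemma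
(`exists_colorful_dominant`). Füredi's bound rests on moving to a vertex of the polytope of
fractional matchings. If the packing number is infinite, the points with rational parameter and the
union of a maximal matching of countable members suffice. -/

/-! ### Scarf's parity lemma for dominant sets. -/

/-- A set is dominant for a family of rankings if no point beats, in every ranking at once, the
lowest ranked member of the set. -/
def IsDominant {T I α : Type*} [LinearOrder α] (r : I → T → α) (σ : Finset T) : Prop :=
  ∀ y, ∃ i, ∀ x ∈ σ, r i y ≤ r i x

namespace IsDominant

variable {T I α : Type*} [LinearOrder α] {r : I → T → α}

theorem mono {σ τ : Finset T} (h : IsDominant r σ) (hτ : τ ⊆ σ) : IsDominant r τ := fun y =>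
  let ⟨i, hi⟩ := h y
  ⟨i, fun x hx => hi x (hτ hx)⟩

theorem exists_eq_min (hr : ∀ i, Function.Injective (r i)) {σ : Finset T} (h : IsDominant r σ)
    {μ : I → T} (hμ : ∀ i, μ i ∈ σ) (hmin : ∀ i, ∀ x ∈ σ, r i (μ i) ≤ r i x) {y : T}
    (hy : y ∈ σ) : ∃ i, μ i = y := by
  obtain ⟨i, hi⟩ := h y
  exact ⟨i, hr i (le_antisymm (hmin i y hy) (hi _ (hμ i)))⟩

/-- A point above the minima in all rankings but `k` is below `x` by maximality and below `τ` by
dominance, so ranking `k` serves it. Any other point is below some `μ l` with l ≠ k, which is itself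
below `x`. -/
theorem insert_of_max [DecidableEq T] {τ : Finset T} (h : IsDominant r τ) {μ : I → T}
    (hμ : ∀ i, μ i ∈ τ) (hmin : ∀ i, ∀ x ∈ τ, r i (μ i) ≤ r i x) {k : I}
    (hk : ∀ y ∈ τ, ∃ l, l ≠ k ∧ μ l = y) {x : T} (hx : ∀ l, l ≠ k → r l (μ l) < r l x)
    (hmax : ∀ y, (∀ l, l ≠ k → r l (μ l) < r l y) → r k y ≤ r k x) :
    x ∉ τ ∧ IsDominant r (insert x τ) := by
  constructor
  · intro hxτ
    obtain ⟨l, hl, rfl⟩ := hk x hxτ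
    exact lt_irrefl _ (hx l hl)
  · intro y
    by_cases hy : ∀ l, l ≠ k → r l (μ l) < r l y
    · refine ⟨k, fun z hz => ?_⟩
      rcases Finset.mem_insert.1 hz with rfl | hz
      · exact hmax y hy
      · obtain ⟨i, hi⟩ := h y
        by_cases hik : i = k
        · exact hik ▸ hi z hz
        · exact absurd (hi _ (hμ i)) (not_le.2 (hy i hik))
    · push Not at hy
      obtain ⟨l, hl, hly⟩ := hy
      refine ⟨l, fun z hz => ?_⟩
      rcases Finset.mem_insert.1 hz with rfl | hz
      · exact hly.trans (hx l hl).le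
      · exact hly.trans (hmin l z hz)

/-- In a dominant set with as many points as rankings, each point is lowest in exactly one ranking.
Let `x` be lowest in ranking `k`; elsewhere the minima of `τ` survive. Since `μ a = μ b` cannot be
lowest twice, `k` is `a` or `b`. -/
theorem max_of_insert [DecidableEq T] [Fintype I] (hr : ∀ i, Function.Injective (r i))
    {τ : Finset T} (hcard : τ.card + 1 = Fintype.card I) {μ : I → T}
    (hμ : ∀ i, μ i ∈ τ) (hmin : ∀ i, ∀ x ∈ τ, r i (μ i) ≤ r i x) {a b : I} (hab : a ≠ b)
    (hμab : μ a = μ b) {x : T} (hxτ : x ∉ τ) (hdom : IsDominant r (insert x τ)) :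
    ∃ k, (k = a ∨ k = b) ∧ (∀ l, l ≠ k → r l (μ l) < r l x) ∧
      ∀ y, (∀ l, l ≠ k → r l (μ l) < r l y) → r k y ≤ r k x := by
  classical
  have hex : ∀ y : (insert x τ : Finset T), ∃ i, ∀ z ∈ insert x τ, r i y ≤ r i z := fun y => hdom y
  choose j hj using hex
  have hjinj : Function.Injective j := by
    intro y y' h
    have h1 := hj y y' y'.2
    have h2 := hj y' y y.2
    rw [← h] at h2
    exact Subtype.ext (hr _ (le_antisymm h1 h2))
  have hjsurj : Function.Surjective j := by
    refine ((Fintype.bijective_iff_injective_and_card j).2 ⟨hjinj, ?_⟩).2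
    rw [Fintype.card_coe, Finset.card_insert_of_notMem hxτ, hcard]
  let X : (insert x τ : Finset T) := ⟨x, Finset.mem_insert_self x τ⟩
  have key : ∀ l, l ≠ j X → ∃ y : (insert x τ : Finset T), y ≠ X ∧ j y = l ∧ (y : T) = μ l := by
    intro l hl
    obtain ⟨y, rfl⟩ := hjsurj l
    have hyX : y ≠ X := fun h => hl (by rw [h])
    refine ⟨y, hyX, rfl, ?_⟩
    have hyτ : (y : T) ∈ τ := by
      rcases Finset.mem_insert.1 y.2 with h | h
      · exact absurd (Subtype.ext h) hyX
      · exact h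
    exact hr (j y) (le_antisymm (hj y _ (Finset.mem_insert_of_mem (hμ _))) (hmin _ _ hyτ))
  have hlt : ∀ l, l ≠ j X → r l (μ l) < r l x := by
    intro l hl
    obtain ⟨y, hyX, rfl, hy⟩ := key l hl
    rw [← hy]
    refine lt_of_le_of_ne (hj y x X.2) fun h => hyX (Subtype.ext (hr _ h))
  refine ⟨j X, ?_, hlt, ?_⟩
  · by_contra hcon
    push Not at hcon
    obtain ⟨y, -, hy, hya⟩ := key a hcon.1.symm
    obtain ⟨y', -, hy', hyb⟩ := key b hcon.2.symm
    have : y = y' := Subtype.ext (by rw [hya, hyb, hμab])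
    exact hab (by rw [← hy, ← hy', this])
  · intro y hy
    obtain ⟨i, hi⟩ := hdom y
    by_cases hik : i = j X
    · exact hik ▸ hi x X.2
    · exact absurd (hi _ (Finset.mem_insert_of_mem (hμ i))) (not_le.2 (hy i hik))

/-- The pseudomanifold property. One point of `τ` is lowest in two rankings `a` and `b`, and freeing
either of them determines one completion. The condition `hout` says that `τ` is not on the boundary.
-/
theorem card_insert_eq_two [DecidableEq T] [Fintype T] [Fintype I]
    (hr : ∀ i, Function.Injective (r i)) {τ : Finset T} (hcard : τ.card + 1 = Fintype.card I)
    (hne : τ.Nonempty) (h : IsDominant r τ)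
    (hout : ∀ k, ∃ y, ∀ l, l ≠ k → ∃ z ∈ τ, r l z < r l y) :
    {x | x ∉ τ ∧ IsDominant r (insert x τ)}.ncard = 2 := by
  classical
  have hex : ∀ i, ∃ m ∈ τ, ∀ x ∈ τ, r i m ≤ r i x := fun i => τ.exists_min_image (r i) hne
  choose μ hμ hmin using hex
  have himg : Finset.univ.image μ = τ := by
    ext y
    constructor
    · intro hy
      obtain ⟨i, -, rfl⟩ := Finset.mem_image.1 hy
      exact hμ i
    · intro hy
      obtain ⟨i, hi⟩ := h.exists_eq_min hr hμ hmin hy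
      exact Finset.mem_image.2 ⟨i, Finset.mem_univ _, hi⟩
  obtain ⟨a, b, hab, hμab⟩ : ∃ a b, a ≠ b ∧ μ a = μ b := by
    obtain ⟨a, -, b, -, h1, h2⟩ := Finset.exists_ne_map_eq_of_card_lt_of_maps_to
      (s := Finset.univ) (t := τ) (f := μ) (by rw [Finset.card_univ]; omega) (fun i _ => hμ i)
    exact ⟨a, b, h1, h2⟩
  have hcover : ∀ k, (k = a ∨ k = b) → ∀ y ∈ τ, ∃ l, l ≠ k ∧ μ l = y := by
    intro k hk y hy
    obtain ⟨l, rfl⟩ := h.exists_eq_min hr hμ hmin hy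
    by_cases hlk : l = k
    · subst hlk
      rcases hk with rfl | rfl
      · exact ⟨b, hab.symm, hμab.symm⟩
      · exact ⟨a, hab, hμab⟩
    · exact ⟨l, hlk, rfl⟩
  have hmax : ∀ k, ∃ x, (∀ l, l ≠ k → r l (μ l) < r l x) ∧
      ∀ y, (∀ l, l ≠ k → r l (μ l) < r l y) → r k y ≤ r k x := by
    intro k
    obtain ⟨y, hy⟩ := hout k
    obtain ⟨x, hx, hx'⟩ := Finset.exists_max_image
      (Finset.univ.filter fun x => ∀ l, l ≠ k → r l (μ l) < r l x) (r k)
      ⟨y, Finset.mem_filter.2 ⟨Finset.mem_univ _, fun l hl =>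
        let ⟨z, hz, hzy⟩ := hy l hl
        (hmin l z hz).trans_lt hzy⟩⟩
    exact ⟨x, (Finset.mem_filter.1 hx).2, fun z hz =>
      hx' z (Finset.mem_filter.2 ⟨Finset.mem_univ _, hz⟩)⟩
  obtain ⟨xa, hxa, hxa'⟩ := hmax a
  obtain ⟨xb, hxb, hxb'⟩ := hmax b
  -- A common point would beat the minimum of `τ` in every ranking.
  have hne' : xa ≠ xb := by
    rintro rfl
    obtain ⟨i, hi⟩ := h xa
    refine absurd (hi _ (hμ i)) (not_le.2 ?_)
    by_cases hia : i = a
    · exact hxb i (hia ▸ hab)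
    · exact hxa i hia
  rw [Set.ncard_eq_two]
  refine ⟨xa, xb, hne', ?_⟩
  ext x
  simp only [Set.mem_ofPred_eq, Set.mem_insert_iff, Set.mem_singleton_iff]
  constructor
  · rintro ⟨hxτ, hdom⟩
    obtain ⟨k, hk, h1, h2⟩ := max_of_insert hr hcard hμ hmin hab hμab hxτ hdom
    rcases hk with rfl | rfl
    · exact Or.inl (hr _ (le_antisymm (hxa' x h1) (h2 _ hxa)))
    · exact Or.inr (hr _ (le_antisymm (hxb' x h1) (h2 _ hxb)))
  · rintro (rfl | rfl)
    · exact h.insert_of_max hμ hmin (hcover a (Or.inl rfl)) hxa hxa'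
    · exact h.insert_of_max hμ hmin (hcover b (Or.inr rfl)) hxb hxb'

end IsDominant

/-- If deleting `x` leaves every color but `i₀` exactly once, the color of `x` occurs once more in
the set, and deleting that other point works too. These are the only two choices. -/
theorem even_card_erase_image {T I : Type*} [DecidableEq T] [Fintype I] [DecidableEq I]
    (c : T → I) (i₀ : I) {σ : Finset T} (hσ : σ.card = Fintype.card I)
    (hc : σ.image c ≠ Finset.univ) :
    Even (σ.filter fun x => (σ.erase x).image c = Finset.univ.erase i₀).card := by
  rcases (σ.filter fun x => (σ.erase x).image c = Finset.univ.erase i₀).eq_empty_or_nonempty with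
    h | ⟨x, hx⟩
  · simp [h]
  obtain ⟨hxσ, hx⟩ := Finset.mem_filter.1 hx
  have hinj : ∀ y ∈ σ, (σ.erase y).image c = Finset.univ.erase i₀ → Set.InjOn c (σ.erase y) := by
    intro y hy h
    apply Finset.injOn_of_card_image_eq
    rw [h, Finset.card_erase_of_mem (Finset.mem_univ _), Finset.card_erase_of_mem hy, hσ,
      Finset.card_univ]
  have himg : σ.image c = insert (c x) ((σ.erase x).image c) := by
    rw [← Finset.image_insert, Finset.insert_erase hxσ]
  have hcx : c x ≠ i₀ := by
    intro h
    apply hc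
    rw [himg, hx, h, Finset.insert_erase (Finset.mem_univ _)]
  obtain ⟨x', hx', hcx'⟩ : ∃ x' ∈ σ.erase x, c x' = c x := by
    rw [← Finset.mem_image, hx]
    simp [hcx]
  obtain ⟨hxx', hx'σ⟩ := Finset.mem_erase.1 hx'
  have heq : (σ.filter fun x => (σ.erase x).image c = Finset.univ.erase i₀) = {x, x'} := by
    ext y
    simp only [Finset.mem_filter, Finset.mem_insert, Finset.mem_singleton]
    constructor
    · rintro ⟨hy, hy'⟩
      by_contra hcon
      push Not at hcon
      exact hxx' (hinj y hy hy' (Finset.mem_coe.2 (Finset.mem_erase.2 ⟨hcon.2.symm, hx'σ⟩))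
        (Finset.mem_coe.2 (Finset.mem_erase.2 ⟨hcon.1.symm, hxσ⟩)) hcx')
    · rintro (rfl | rfl)
      · exact ⟨hxσ, hx⟩
      · refine ⟨hx'σ, ?_⟩
        rw [← hx]
        have h1 : σ.erase y = insert x ((σ.erase x).erase y) := by
          ext z; simp only [Finset.mem_erase, Finset.mem_insert]
          by_cases hz : z = x
          · subst hz; simp [hxx'.symm, hxσ]
          · simp [hz]
        have h2 : σ.erase x = insert y ((σ.erase x).erase y) := (Finset.insert_erase hx').symm
        rw [h1, Finset.image_insert, ← hcx', ← Finset.image_insert, ← h2]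
  rw [heq, Finset.card_pair hxx'.symm]
  exact even_two

/-- Count incidences between rooms (dominant sets of size |I|) and doors (sets with one point of
each color except `i₀`). Without a fully colored room, every room has an even number of doors. Every
door lies in zero or two rooms, except the one made of the `e l` with l ≠ i₀, which lies in one. The
total would be both even and odd. -/
theorem exists_colorful_dominant {T I α : Type*} [Fintype T] [Fintype I] [Nontrivial I]
    [LinearOrder α] (r : I → T → α) (hr : ∀ i, Function.Injective (r i)) (e : I → T)
    (hbot : ∀ i y, r i (e i) ≤ r i y)
    (htop : ∀ i l, l ≠ i → ∀ y, y ∉ Set.range e → r i y < r i (e l))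
    (c : T → I) (hc : ∀ i, c (e i) = i) :
    ∃ x : I → T, (∀ i, c (x i) = i) ∧ ∀ y, ∃ i, ∀ l, r i y ≤ r i (x l) := by
  classical
  have he : Function.Injective e := fun i j h => by rw [← hc i, ← hc j, h]
  suffices hroom : ∃ σ : Finset T, IsDominant r σ ∧ σ.image c = Finset.univ by
    obtain ⟨σ, hσ, hσc⟩ := hroom
    have : ∀ i, ∃ x ∈ σ, c x = i := fun i =>
      Finset.mem_image.1 (by rw [hσc]; exact Finset.mem_univ i)
    choose x hx hcx using this
    exact ⟨x, hcx, fun y => let ⟨i, hi⟩ := hσ y; ⟨i, fun l => hi _ (hx l)⟩⟩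
  by_contra hcon
  push Not at hcon
  obtain ⟨i₀⟩ : Nonempty I := inferInstance
  let R : Finset (Finset T) :=
    Finset.univ.filter fun σ => σ.card = Fintype.card I ∧ IsDominant r σ
  let D : Finset (Finset T) := Finset.univ.filter fun τ =>
    τ.card + 1 = Fintype.card I ∧ τ.image c = Finset.univ.erase i₀
  have hcount := Finset.sum_card_bipartiteAbove_eq_sum_card_bipartiteBelow
    (s := D) (t := R) (fun τ σ => τ ⊆ σ)
  have hR : Even (∑ σ ∈ R, (Finset.bipartiteBelow (fun τ σ => τ ⊆ σ) D σ).card) := by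
    refine Finset.even_sum _ fun σ hσ => ?_
    obtain ⟨-, hσn, hσd⟩ := Finset.mem_filter.1 hσ
    have h1 : Finset.bipartiteBelow (fun τ σ => τ ⊆ σ) D σ =
        (σ.filter fun x => (σ.erase x).image c = Finset.univ.erase i₀).image σ.erase := by
      ext τ
      simp only [Finset.mem_bipartiteBelow, Finset.mem_image, Finset.mem_filter, D,
        Finset.mem_univ, true_and]
      constructor
      · rintro ⟨⟨h1, h2⟩, h3⟩
        have h4 : (σ \ τ).card = 1 := by rw [Finset.card_sdiff_of_subset h3]; omega
        obtain ⟨x, hx⟩ := Finset.card_eq_one.1 h4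
        have hxm : x ∈ σ \ τ := by rw [hx]; simp
        have h5 : σ.erase x = τ := by
          rw [← Finset.sdiff_singleton_eq_erase, ← hx, Finset.sdiff_sdiff_eq_self h3]
        exact ⟨x, ⟨(Finset.mem_sdiff.1 hxm).1, by rw [h5, h2]⟩, h5⟩
      · rintro ⟨x, ⟨h1, h2⟩, rfl⟩
        refine ⟨⟨?_, h2⟩, Finset.erase_subset _ _⟩
        rw [Finset.card_erase_add_one h1, hσn]
    rw [h1, Finset.card_image_of_injOn]
    · exact even_card_erase_image c i₀ hσn (hcon σ hσd)
    · intro x hx y hy hxy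
      exact Finset.erase_injOn σ (Finset.mem_coe.2 (Finset.mem_filter.1 hx).1)
        (Finset.mem_coe.2 (Finset.mem_filter.1 hy).1) hxy
  have hdoor : ∀ τ ∈ D, (Finset.bipartiteAbove (fun τ σ => τ ⊆ σ) R τ).card =
      {x | x ∉ τ ∧ IsDominant r (insert x τ)}.ncard := by
    intro τ hτ
    obtain ⟨-, hτn, -⟩ := Finset.mem_filter.1 hτ
    have h1 : Finset.bipartiteAbove (fun τ σ => τ ⊆ σ) R τ =
        (Finset.univ.filter fun x => x ∉ τ ∧ IsDominant r (insert x τ)).image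
          (fun x => insert x τ) := by
      ext σ
      simp only [Finset.mem_bipartiteAbove, Finset.mem_image, Finset.mem_filter, R,
        Finset.mem_univ, true_and]
      constructor
      · rintro ⟨⟨h1, h2⟩, h3⟩
        have h4 : (σ \ τ).card = 1 := by rw [Finset.card_sdiff_of_subset h3]; omega
        obtain ⟨x, hx⟩ := Finset.card_eq_one.1 h4
        have hxm : x ∈ σ \ τ := by rw [hx]; simp
        have h5 : insert x τ = σ := by
          rw [Finset.insert_eq, ← hx, Finset.sdiff_union_of_subset h3]
        exact ⟨x, ⟨(Finset.mem_sdiff.1 hxm).2, by rwa [h5]⟩, h5⟩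
      · rintro ⟨x, ⟨h1, h2⟩, rfl⟩
        exact ⟨⟨by rw [Finset.card_insert_of_notMem h1, hτn], h2⟩, Finset.subset_insert _ _⟩
    rw [h1, Finset.card_image_of_injOn, ← Set.ncard_coe_finset]
    · simp
    · intro x hx y hy hxy
      have hx' := (Finset.mem_filter.1 hx).2.1
      have : x ∈ insert y τ := by
        have h : insert x τ = insert y τ := hxy
        rw [← h]; exact Finset.mem_insert_self _ _
      rcases Finset.mem_insert.1 this with h | h
      · exact h
      · exact absurd h hx'
  let τ₀ : Finset T := (Finset.univ.erase i₀).image e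
  have hcard_e : ∀ l, ((Finset.univ.erase l).image e).card + 1 = Fintype.card I := by
    intro l
    rw [Finset.card_image_of_injective _ he, Finset.card_erase_add_one (Finset.mem_univ _),
      Finset.card_univ]
  have himg_e : ∀ l, ((Finset.univ.erase l).image e).image c = Finset.univ.erase l := by
    intro l
    rw [Finset.image_image]
    have : c ∘ e = id := funext hc
    rw [this, Finset.image_id]
  have hτ₀ : τ₀ ∈ D := Finset.mem_filter.2 ⟨Finset.mem_univ _, hcard_e i₀, himg_e i₀⟩
  have heτ₀ : e i₀ ∉ τ₀ := by
    intro h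
    obtain ⟨l, hl, hle⟩ := Finset.mem_image.1 h
    exact (Finset.mem_erase.1 hl).1 (he hle)
  -- Only the highest point of ranking `i₀` outside `τ₀` completes this boundary door.
  have hone : {x | x ∉ τ₀ ∧ IsDominant r (insert x τ₀)}.ncard = 1 := by
    obtain ⟨x₀, hx₀, hmax⟩ := Finset.exists_max_image τ₀ᶜ (r i₀) ⟨e i₀, by simpa using heτ₀⟩
    rw [Finset.mem_compl] at hx₀
    have hdom : ∀ x, x ∉ τ₀ → (IsDominant r (insert x τ₀) ↔ ∀ y, y ∉ τ₀ → r i₀ y ≤ r i₀ x) := by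
      intro x hx
      constructor
      · intro h y hy
        obtain ⟨i, hi⟩ := h y
        by_cases hii : i = i₀
        · exact hii ▸ hi x (Finset.mem_insert_self _ _)
        · have hei : e i ∈ τ₀ :=
            Finset.mem_image_of_mem e (Finset.mem_erase.2 ⟨hii, Finset.mem_univ _⟩)
          have := hr i (le_antisymm (hi _ (Finset.mem_insert_of_mem hei)) (hbot i y))
          exact absurd (this ▸ hei) hy
      · intro h y
        by_cases hy : y ∈ τ₀
        · obtain ⟨l, -, rfl⟩ := Finset.mem_image.1 hy
          exact ⟨l, fun x _ => hbot l x⟩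
        · refine ⟨i₀, fun z hz => ?_⟩
          rcases Finset.mem_insert.1 hz with rfl | hz
          · exact h y hy
          · obtain ⟨l, hl, rfl⟩ := Finset.mem_image.1 hz
            by_cases hye : y ∈ Set.range e
            · obtain ⟨k, rfl⟩ := hye
              have hk : k = i₀ := by
                by_contra hk
                exact hy (Finset.mem_image_of_mem e (Finset.mem_erase.2 ⟨hk, Finset.mem_univ _⟩))
              exact hk ▸ hbot k _
            · exact (htop i₀ l (Finset.mem_erase.1 hl).1 y hye).le
    rw [Set.ncard_eq_one]
    refine ⟨x₀, ?_⟩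
    ext x
    simp only [Set.mem_ofPred_eq, Set.mem_singleton_iff]
    constructor
    · rintro ⟨h1, h2⟩
      exact hr i₀ (le_antisymm (hmax x (by simpa using h1)) ((hdom x h1).1 h2 x₀ hx₀))
    · rintro rfl
      exact ⟨hx₀, (hdom x hx₀).2 fun y hy => hmax y (by simpa using hy)⟩
  have heven : ∀ τ ∈ D.erase τ₀, Even (Finset.bipartiteAbove (fun τ σ => τ ⊆ σ) R τ).card := by
    intro τ hτ
    obtain ⟨hττ₀, hτD⟩ := Finset.mem_erase.1 hτ
    obtain ⟨-, hτn, hτc⟩ := Finset.mem_filter.1 hτD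
    rw [hdoor τ hτD]
    by_cases hdom : IsDominant r τ
    · rw [hdom.card_insert_eq_two hr hτn]
      · exact even_two
      · rw [← Finset.card_pos]
        have := Fintype.one_lt_card (α := I)
        omega
      · intro k
        -- If `e k` failed in ranking `l`, then `τ` would consist of all `e m` with m ≠ l, and its
        -- colors would make it `τ₀`.
        refine ⟨e k, fun l hl => ?_⟩
        by_contra hno
        push Not at hno
        apply hττ₀
        have hsub : τ ⊆ (Finset.univ.erase l).image e := by
          intro z hz
          have hzr : z ∈ Set.range e := by
            by_contra hzr
            exact absurd (hno z hz) (not_le.2 (htop l k hl.symm z hzr))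
          obtain ⟨m, rfl⟩ := hzr
          refine Finset.mem_image_of_mem e (Finset.mem_erase.2 ⟨?_, Finset.mem_univ _⟩)
          rintro rfl
          exact hl (he (hr m (le_antisymm (hbot m _) (hno _ hz))))
        have heq := Finset.eq_of_subset_of_card_le hsub (by have := hcard_e l; omega)
        have : l = i₀ := by
          have h := himg_e l
          rw [← heq, hτc] at h
          by_contra hli
          have : l ∈ Finset.univ.erase l := by
            rw [← h]; exact Finset.mem_erase.2 ⟨hli, Finset.mem_univ _⟩
          simp at this
        rw [heq, this]
    · have : {x | x ∉ τ ∧ IsDominant r (insert x τ)} = ∅ := by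
        ext x
        simp only [Set.mem_ofPred_eq, Set.mem_empty_iff_false, iff_false, not_and]
        exact fun _ h => hdom (h.mono (Finset.subset_insert _ _))
      simp [this]
  rw [← Finset.sum_erase_add _ _ hτ₀, hdoor τ₀ hτ₀, hone] at hcount
  rw [← hcount, Nat.even_add_one] at hR
  exact hR (Finset.even_sum _ heven)

/-! ### Brouwer's theorem on the simplex. -/

/-- Rank the grid points by each coordinate. A colorful dominant set has lowest values `a i` so
large that no grid point exceeds them all. This forces their sum above m, so its grid points are
confined to a small simplex. -/
theorem exists_colorful_near_grid_points {I : Type*} [Fintype I] [Nontrivial I] (m : ℕ)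
    (c : (I → ℕ) → I) :
    ∃ (a : I → ℕ) (S : Set (I → ℕ)), S.Nonempty ∧ (∀ z ∈ S, ∑ i, z i = m) ∧
      (∀ z ∈ S, ∀ i, a i ≤ z i + 1 ∧ z i + 1 ≤ a i + Fintype.card I) ∧
      ∀ i, a i = 0 ∨ ∃ z ∈ S, c z = i := by
  classical
  let G := {y : I → Fin (m + 1) // ∑ i, (y i : ℕ) = m}
  let g : G → I → ℕ := fun y i => y.1 i
  -- The shift by one puts grid values strictly between 0, the value of `inl i` in ranking `i`, and
  -- m + 2, its value in the others. The second component of `r` only breaks ties.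
  let v : I → I ⊕ G → ℕ := fun i t => t.elim (fun l => if l = i then 0 else m + 2)
    (fun y => g y i + 1)
  let r : I → I ⊕ G → ℕ ×ₗ ℕ := fun i t => toLex (v i t, (Fintype.equivFin (I ⊕ G) t : ℕ))
  have hr : ∀ i, Function.Injective (r i) := by
    intro i s t h
    have h2 := congrArg (fun p => (ofLex p).2) h
    exact (Fintype.equivFin (I ⊕ G)).injective (Fin.ext h2)
  have hle : ∀ i s t, r i s ≤ r i t → v i s ≤ v i t := by
    intro i s t h
    rcases Prod.Lex.le_iff.1 h with h | h
    · exact h.le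
    · exact h.1.le
  have hlt : ∀ i s t, v i s < v i t → r i s < r i t := fun i s t h =>
    Prod.Lex.lt_iff.2 (Or.inl h)
  have hvg : ∀ i y, v i (Sum.inr y) < m + 2 := by
    intro i y
    have := (y.1 i).2
    change (y.1 i : ℕ) + 1 < m + 2
    omega
  have hv0 : ∀ i, v i (Sum.inl i) = 0 := fun i => if_pos rfl
  have hv1 : ∀ i l, l ≠ i → v i (Sum.inl l) = m + 2 := fun i l h => if_neg h
  obtain ⟨x, hxc, hxd⟩ := exists_colorful_dominant r hr Sum.inl
    (by
      intro i y
      by_cases hy : y = Sum.inl i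
      · rw [hy]
      · refine (hlt _ _ _ ?_).le
        rw [hv0]
        rcases y with l | y
        · rw [hv1 i l (fun h => hy (by rw [h]))]; omega
        · exact Nat.succ_pos _)
    (by
      intro i l hl y hy
      apply hlt
      rw [hv1 i l hl]
      rcases y with k | y
      · exact absurd ⟨k, rfl⟩ hy
      · exact hvg i y)
    (Sum.elim id fun y => c (g y)) (fun i => rfl)
  have hmin : ∀ i, ∃ l, ∀ l', v i (x l) ≤ v i (x l') := fun i =>
    Finite.exists_min fun l => v i (x l)
  choose l hl using hmin
  let a : I → ℕ := fun i => v i (x (l i))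
  have hda : ∀ y : G, ∃ i, g y i + 1 ≤ a i := by
    intro y
    obtain ⟨i, hi⟩ := hxd (Sum.inr y)
    exact ⟨i, hle _ _ _ (hi (l i))⟩
  -- Otherwise `a`, raised at one coordinate until the sum is m, is a grid point contradicting
  -- dominance.
  have hsum : m + 1 ≤ ∑ i, a i := by
    by_contra hcon
    obtain ⟨i₀⟩ : Nonempty I := inferInstance
    let y : I → ℕ := fun i => a i + if i = i₀ then m - ∑ i, a i else 0
    have hy : ∑ i, y i = m := by
      simp only [y, Finset.sum_add_distrib, Finset.sum_ite_eq', Finset.mem_univ, if_true]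
      omega
    have hym : ∀ i, y i < m + 1 := fun i => by
      have := Finset.single_le_sum (f := y) (fun i _ => Nat.zero_le _) (Finset.mem_univ i)
      omega
    obtain ⟨i, hi⟩ := hda ⟨fun i => ⟨y i, hym i⟩, hy⟩
    have : a i ≤ y i := Nat.le_add_right _ _
    change y i + 1 ≤ a i at hi
    omega
  refine ⟨a, {z | ∃ k y, x k = Sum.inr y ∧ z = g y}, ?_, ?_, ?_, ?_⟩
  · by_contra hne
    have hx : ∀ k, x k = Sum.inl k := by
      intro k
      rcases hk : x k with j | y
      · have := hxc k
        rw [hk] at this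
        exact congrArg _ this
      · exact absurd ⟨_, k, y, hk, rfl⟩ hne
    have : ∑ i, a i = 0 := Finset.sum_eq_zero fun i _ => by
      have := hl i i
      rw [hx i, hv0] at this
      exact Nat.le_zero.1 this
    omega
  · rintro z ⟨k, y, hk, rfl⟩
    exact y.2
  · rintro z ⟨k, y, hk, rfl⟩ i
    have h1 : ∀ i, a i ≤ g y i + 1 := fun i => by
      have := hl i k
      rwa [hk] at this
    refine ⟨h1 i, ?_⟩
    have h2 : ∑ i, (g y i + 1) = m + Fintype.card I := by
      rw [Finset.sum_add_distrib, y.2]; simp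
    have h3 : ∑ j ∈ Finset.univ.erase i, a j ≤ ∑ j ∈ Finset.univ.erase i, (g y j + 1) :=
      Finset.sum_le_sum fun j _ => h1 j
    have h4 := Finset.add_sum_erase Finset.univ a (Finset.mem_univ i)
    have h5 := Finset.add_sum_erase Finset.univ (fun j => g y j + 1) (Finset.mem_univ i)
    omega
  · intro i
    rcases hi : x i with j | y
    · left
      have h := hxc i
      rw [hi] at h
      change j = i at h
      have := hl i i
      rw [hi, h, hv0] at this
      exact Nat.le_zero.1 this
    · right
      have h := hxc i
      rw [hi] at h
      exact ⟨g y, ⟨i, y, hi, rfl⟩, h⟩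

/-- Brouwer's fixed point theorem for the standard simplex. -/
theorem exists_fixedPoint_stdSimplex {I : Type*} [Fintype I] [Nontrivial I]
    (f : (I → ℝ) → I → ℝ) (hf : ContinuousOn f (stdSimplex ℝ I))
    (hmaps : Set.MapsTo f (stdSimplex ℝ I) (stdSimplex ℝ I)) :
    ∃ x ∈ stdSimplex ℝ I, f x = x := by
  classical
  by_contra! hno
  have hcompact := isCompact_stdSimplex ℝ I
  have hlow : ∀ z ∈ stdSimplex ℝ I, ∃ i, f z i < z i := by
    intro z hz
    by_contra! h
    apply hno z hz
    have hsum : ∑ i, z i = ∑ i, f z i := by rw [hz.2, (hmaps hz).2]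
    have := (Finset.sum_eq_sum_iff_of_le fun i _ => h i).1 hsum
    exact funext fun i => (this i (Finset.mem_univ i)).symm
  have hhigh : ∀ z ∈ stdSimplex ℝ I, ∃ i, z i ≤ f z i := by
    intro z hz
    by_contra! h
    have := Finset.sum_lt_sum_of_nonempty (s := Finset.univ) Finset.univ_nonempty
      fun i _ => h i
    rw [hz.2, (hmaps hz).2] at this
    exact lt_irrefl _ this
  -- Compactness makes the drop in some coordinate uniform.
  obtain ⟨ε, hε, hgap⟩ : ∃ ε > 0, ∀ z ∈ stdSimplex ℝ I, ∃ i, f z i + ε ≤ z i := by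
    let φ : (I → ℝ) → ℝ := fun z => Finset.univ.sup' Finset.univ_nonempty fun i => z i - f z i
    have hφ : ContinuousOn φ (stdSimplex ℝ I) := by
      apply ContinuousOn.finset_sup'_apply
      intro i _
      exact (continuous_apply i).continuousOn.sub ((continuous_apply i).comp_continuousOn hf)
    obtain ⟨i₀⟩ : Nonempty I := inferInstance
    obtain ⟨z₀, hz₀, hmin⟩ := hcompact.exists_isMinOn ⟨_, single_mem_stdSimplex ℝ i₀⟩ hφ
    refine ⟨φ z₀, ?_, fun z hz => ?_⟩
    · obtain ⟨i, hi⟩ := hlow z₀ hz₀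
      exact (Finset.lt_sup'_iff _).2 ⟨i, Finset.mem_univ i, by linarith⟩
    · have hz' : φ z₀ ≤ φ z := hmin hz
      obtain ⟨i, -, hi⟩ := (Finset.le_sup'_iff _).1 hz'
      exact ⟨i, by linarith⟩
  obtain ⟨δ, hδ, hunif⟩ := Metric.uniformContinuousOn_iff.1
    (hcompact.uniformContinuousOn_of_continuous hf) (ε / 3) (by positivity)
  set n := Fintype.card I with hn
  obtain ⟨m, hm⟩ := exists_nat_gt (max (n / δ) (n / (ε / 3)))
  have hn0 : (0 : ℝ) < n := by exact_mod_cast Fintype.card_pos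
  have hmδ : n / δ < m := (le_max_left _ _).trans_lt hm
  have hmε : n / (ε / 3) < m := (le_max_right _ _).trans_lt hm
  have hm0 : (0 : ℝ) < m := (by positivity : (0 : ℝ) < n / δ).trans hmδ
  have hnm1 : (n : ℝ) / m < δ := by
    rw [div_lt_iff₀ hm0]; rw [div_lt_iff₀ hδ] at hmδ; linarith
  have hnm2 : (n : ℝ) / m < ε / 3 := by
    rw [div_lt_iff₀ hm0]; rw [div_lt_iff₀ (by positivity)] at hmε; linarith
  let s : (I → ℕ) → I → ℝ := fun z i => z i / m
  have hs : ∀ z : I → ℕ, ∑ i, z i = m → s z ∈ stdSimplex ℝ I := by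
    intro z hz
    refine ⟨fun i => by positivity, ?_⟩
    rw [← Finset.sum_div, ← Nat.cast_sum, hz, div_self hm0.ne']
  -- The color is a coordinate that `f` does not decrease. Near a point of `S` where coordinate `i`
  -- drops by `ε` lies one of color `i`, unless that coordinate is itself below `ε / 3`; both are
  -- impossible.
  have hcol : ∀ z : I → ℕ, ∃ i, ∑ i, z i = m → s z i ≤ f (s z) i := by
    intro z
    by_cases hz : ∑ i, z i = m
    · obtain ⟨i, hi⟩ := hhigh _ (hs z hz)
      exact ⟨i, fun _ => hi⟩
    · obtain ⟨i₀⟩ : Nonempty I := inferInstance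
      exact ⟨i₀, fun h => absurd h hz⟩
  choose c hc using hcol
  obtain ⟨a, S, ⟨z, hzS⟩, hSm, hSa, hSc⟩ := exists_colorful_near_grid_points m c
  have hnear : ∀ z ∈ S, ∀ z' ∈ S, ∀ i, s z i ≤ s z' i + n / m := by
    intro z hz z' hz' i
    have h1 := (hSa z hz i).2
    have h2 := (hSa z' hz' i).1
    have : (z i : ℝ) ≤ z' i + n := by
      have : z i ≤ z' i + n := by omega
      exact_mod_cast this
    simp only [s]
    rw [← add_div]
    gcongr
  obtain ⟨i, hi⟩ := hgap _ (hs z (hSm z hzS))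
  rcases hSc i with h0 | ⟨z', hz'S, hz'c⟩
  · have h1 := (hSa z hzS i).2
    have h2 : (z i : ℝ) ≤ n := by
      have : z i ≤ n := by omega
      exact_mod_cast this
    have h3 : s z i ≤ n / m := by simp only [s]; gcongr
    have h4 := (hmaps (hs z (hSm z hzS))).1 i
    linarith
  · have hdist : dist (s z) (s z') < δ := by
      rw [dist_pi_lt_iff hδ]
      intro j
      rw [Real.dist_eq, abs_lt]
      have h1 := hnear z hzS z' hz'S j
      have h2 := hnear z' hz'S z hzS j
      constructor <;> linarith
    have h1 := hunif _ (hs z (hSm z hzS)) _ (hs z' (hSm z' hz'S)) hdist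
    have h2 := (dist_le_pi_dist (f (s z)) (f (s z')) i).trans_lt h1
    rw [Real.dist_eq, abs_lt] at h2
    have h3 := hc z' (hSm z' hz'S)
    rw [hz'c] at h3
    have h4 := hnear z hzS z' hz'S i
    linarith [h2.1]

/-! ### Equalizing weights on a product of simplices. -/

/-- Nonnegative continuous weights on a product of simplices, each vanishing together with its
barycentric coordinate, can be made equal within each factor. -/
theorem exists_equalized_weights {d N : ℕ} (hd : 2 ≤ d) (hN : 0 < N)
    (W : (Fin d → Fin N → ℝ) → Fin d → Fin N → ℝ) (hW : Continuous W)
    (hpos : ∀ x i j, 0 ≤ W x i j)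
    (hzero : ∀ x, (∀ i, x i ∈ stdSimplex ℝ (Fin N)) → ∀ i j, x i j = 0 → W x i j = 0) :
    ∃ x : Fin d → Fin N → ℝ, (∀ i, x i ∈ stdSimplex ℝ (Fin N)) ∧
      ∀ i j j', W x i j = W x i j' := by
  classical
  have : NeZero N := ⟨hN.ne'⟩
  have : Nontrivial (Fin d) := Fin.nontrivial_iff_two_le.2 hd
  have hd0 : (0 : ℝ) < d := by exact_mod_cast (by omega : 0 < d)
  have hN0 : (0 : ℝ) < N := by exact_mod_cast hN
  let σ : (Fin d × Fin N → ℝ) → Fin d → ℝ := fun y i => ∑ j, d * y (i, j)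
  -- This maps one large simplex to the product: scale by d, fill rows of sum below one evenly,
  -- normalize rows of sum above one. Rows of sum 1/d are just rescaled.
  let ρ : (Fin d × Fin N → ℝ) → Fin d → Fin N → ℝ := fun y i j =>
    (d * y (i, j) + max 0 (1 - σ y i) / N) / max 1 (σ y i)
  let A : (Fin d → Fin N → ℝ) → Fin d → ℝ := fun x i => (∑ j, W x i j) / N
  let P : (Fin d → Fin N → ℝ) → Fin d → Fin N → ℝ := fun x i j => max 0 (A x i - W x i j)
  -- As in Nash's argument, mass moves towards the pieces of weight below the average.
  let g : (Fin d → Fin N → ℝ) → Fin d → Fin N → ℝ := fun x i j =>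
    (x i j + P x i j) / (1 + ∑ j, P x i j)
  let f : (Fin d × Fin N → ℝ) → Fin d × Fin N → ℝ := fun y p => g (ρ y) p.1 p.2 / d
  have hmax1 : ∀ y i, 0 < max 1 (σ y i) := fun y i => lt_max_of_lt_left one_pos
  have hP0 : ∀ x i j, 0 ≤ P x i j := fun x i j => le_max_left _ _
  have hPs : ∀ x i, 0 < 1 + ∑ j, P x i j := fun x i => by
    have := Finset.sum_nonneg fun j (_ : j ∈ Finset.univ) => hP0 x i j
    linarith
  have hρmem : ∀ y ∈ stdSimplex ℝ (Fin d × Fin N), ∀ i, ρ y i ∈ stdSimplex ℝ (Fin N) := by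
    intro y hy i
    refine ⟨fun j => ?_, ?_⟩
    · have := hy.1 (i, j)
      have := hmax1 y i
      have : 0 ≤ max 0 (1 - σ y i) := le_max_left _ _
      simp only [ρ]
      positivity
    · simp only [ρ]
      rw [← Finset.sum_div, Finset.sum_add_distrib, div_eq_one_iff_eq (hmax1 y i).ne']
      change σ y i + _ = _
      simp only [Finset.sum_const, Finset.card_univ, Fintype.card_fin, nsmul_eq_mul]
      rw [mul_div_cancel₀ _ hN0.ne']
      rcases le_total 1 (σ y i) with h | h
      · rw [max_eq_left (by linarith), max_eq_right h]; ring
      · rw [max_eq_right (by linarith), max_eq_left h]; ring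
  have hgmem : ∀ x : Fin d → Fin N → ℝ, (∀ i, x i ∈ stdSimplex ℝ (Fin N)) →
      ∀ i, g x i ∈ stdSimplex ℝ (Fin N) := by
    intro x hx i
    refine ⟨fun j => div_nonneg (add_nonneg ((hx i).1 j) (hP0 x i j)) (hPs x i).le, ?_⟩
    simp only [g]
    rw [← Finset.sum_div, Finset.sum_add_distrib, (hx i).2, div_self (hPs x i).ne']
  have hWc : ∀ i j, Continuous fun x => W x i j := fun i j =>
    (continuous_apply j).comp ((continuous_apply i).comp hW)
  have hAc : ∀ i, Continuous fun x => A x i := fun i =>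
    (continuous_finsetSum _ fun j _ => hWc i j).div_const _
  have hPc : ∀ i j, Continuous fun x => P x i j := fun i j =>
    continuous_const.max ((hAc i).sub (hWc i j))
  have hgc : ∀ i j, Continuous fun x => g x i j := fun i j =>
    (((continuous_apply j).comp (continuous_apply i)).add (hPc i j)).div
      (continuous_const.add (continuous_finsetSum _ fun j _ => hPc i j)) fun x => (hPs x i).ne'
  have hσc : ∀ i, Continuous fun y => σ y i := fun i =>
    continuous_finsetSum _ fun j _ => continuous_const.mul (continuous_apply _)
  have hρc : Continuous ρ := continuous_pi fun i => continuous_pi fun j =>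
    ((continuous_const.mul (continuous_apply _)).add
      ((continuous_const.max (continuous_const.sub (hσc i))).div_const _)).div
      (continuous_const.max (hσc i)) fun y => (hmax1 y i).ne'
  have hfc : Continuous f := continuous_pi fun p => ((hgc p.1 p.2).comp hρc).div_const _
  have hrow : ∀ y ∈ stdSimplex ℝ (Fin d × Fin N), ∀ i, ∑ j, f y (i, j) = 1 / d := by
    intro y hy i
    simp only [f]
    rw [← Finset.sum_div, (hgmem _ (hρmem y hy) i).2]
  obtain ⟨y, hy, hfy⟩ := exists_fixedPoint_stdSimplex f hfc.continuousOn (by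
    intro y hy
    refine ⟨fun p => div_nonneg ((hgmem _ (hρmem y hy) p.1).1 p.2) hd0.le, ?_⟩
    rw [Fintype.sum_prod_type]
    simp only [hrow y hy]
    simp [hd0.ne'])
  have hσ : ∀ i, σ y i = 1 := by
    intro i
    have := hrow y hy i
    rw [hfy] at this
    simp only [σ]
    rw [← Finset.mul_sum, this, mul_one_div, div_self hd0.ne']
  have hρ : ∀ i j, ρ y i j = d * y (i, j) := by
    intro i j
    simp only [ρ, hσ]
    simp
  set x := ρ y with hx
  have hfix : ∀ i j, g x i j = x i j := by
    intro i j
    have := congrFun hfy (i, j)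
    simp only [f] at this
    rw [div_eq_iff hd0.ne'] at this
    rw [hρ, ← hx] at *
    rw [this]; ring
  refine ⟨x, hρmem y hy, ?_⟩
  have hxmem := hρmem y hy
  rw [← hx] at hxmem
  have hAN : ∀ i, ∑ j, W x i j = ∑ _j : Fin N, A x i := by
    intro i
    simp only [A, Finset.sum_const, Finset.card_univ, Fintype.card_fin, nsmul_eq_mul]
    field_simp
  suffices h : ∀ i j, A x i ≤ W x i j by
    intro i j j'
    have := (Finset.sum_eq_sum_iff_of_le fun j _ => h i j).1 (hAN i).symm
    rw [← this j (Finset.mem_univ _), ← this j' (Finset.mem_univ _)]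
  intro i
  have hmul : ∀ j, x i j * ∑ j, P x i j = P x i j := by
    intro j
    have := hfix i j
    simp only [g] at this
    rw [div_eq_iff (hPs x i).ne'] at this
    linarith
  by_contra! hcon
  obtain ⟨j, hj⟩ := hcon
  have hPj : 0 < P x i j := lt_max_of_lt_right (by linarith)
  have hS : 0 < ∑ j, P x i j :=
    hPj.trans_le (Finset.single_le_sum (fun j _ => hP0 x i j) (Finset.mem_univ j))
  have hA : 0 < A x i := (hpos x i j).trans_lt hj
  -- At a fixed point a piece of length zero has weight zero, and one of positive length also
  -- receives mass. So all weights would lie below their average.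
  have hlt : ∀ k, W x i k < A x i := by
    intro k
    rcases (hxmem i).1 k |>.eq_or_lt with h | h
    · rw [hzero x hxmem i k h.symm]; exact hA
    · have h1 : 0 < P x i k := by rw [← hmul k]; exact mul_pos h hS
      rcases lt_max_iff.1 h1 with h2 | h2
      · exact absurd h2 (lt_irrefl _)
      · linarith
  exact (Finset.sum_lt_sum_of_nonempty Finset.univ_nonempty fun k _ => hlt k).ne (hAN i)

/-! ### Fractional matchings and Füredi's bound. -/

/-- The ratio test of the simplex method: `t` is the first time at which a coordinate of `α + t * β`
vanishes. -/
theorem exists_pos_ratio {K : Type*} [Fintype K] (α β : K → ℝ) (hα : ∀ k, 0 ≤ α k)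
    (hαβ : ∀ k, α k = 0 → β k = 0) (hβ : ∃ k, β k < 0) :
    ∃ t > 0, (∀ k, 0 ≤ α k + t * β k) ∧ ∃ k, 0 < α k ∧ α k + t * β k = 0 := by
  classical
  obtain ⟨k₁, hk₁⟩ := hβ
  obtain ⟨k₀, hk₀, hmin⟩ := Finset.exists_min_image (Finset.univ.filter fun k => β k < 0)
    (fun k => α k / -β k) ⟨k₁, by simpa using hk₁⟩
  have hβ₀ : β k₀ < 0 := (Finset.mem_filter.1 hk₀).2
  have hα₀ : 0 < α k₀ := (hα k₀).lt_of_ne fun h => hβ₀.ne (hαβ k₀ h.symm)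
  have ht : 0 < α k₀ / -β k₀ := div_pos hα₀ (by linarith)
  refine ⟨α k₀ / -β k₀, ht, fun k => ?_, k₀, hα₀, ?_⟩
  · by_cases hk : β k < 0
    · have := hmin k (by simpa using hk)
      rw [le_div_iff₀ (by linarith)] at this
      linarith
    · have := mul_nonneg ht.le (not_lt.1 hk)
      have := hα k
      linarith
  · have : β k₀ ≠ 0 := hβ₀.ne
    field_simp
    ring

section Hypergraph

variable {ι V D : Type*} [Fintype ι] [DecidableEq V] [Fintype D]

/-- The total weight of the edges through a vertex. -/
def vertexWeight (e : ι → Finset V) (w : ι → ℝ) (v : V) : ℝ := ∑ a, if v ∈ e a then w a else 0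

theorem vertexWeight_add_mul (e : ι → Finset V) (w z : ι → ℝ) (t : ℝ) (v : V) :
    vertexWeight e (fun a => w a + t * z a) v = vertexWeight e w v + t * vertexWeight e z v := by
  simp only [vertexWeight, Finset.mul_sum, ← Finset.sum_add_distrib]
  refine Finset.sum_congr rfl fun a _ => ?_
  split_ifs <;> ring

theorem vertexWeight_const_mul (e : ι → Finset V) (w : ι → ℝ) (t : ℝ) (v : V) :
    vertexWeight e (fun a => t * w a) v = t * vertexWeight e w v := by
  simp only [vertexWeight, Finset.mul_sum]
  refine Finset.sum_congr rfl fun a _ => ?_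
  split_ifs <;> ring

/-- A fractional matching is a nonnegative weighting of the edges whose total at each vertex is at
most one. -/
def IsFractionalMatching (e : ι → Finset V) (w : ι → ℝ) : Prop :=
  (∀ a, 0 ≤ w a) ∧ ∀ v, vertexWeight e w v ≤ 1

/-- The slacks in the inequalities that define fractional matchings. -/
def matchingSlack (e : ι → Finset V) (w : ι → ℝ) : ι ⊕ V → ℝ :=
  Sum.elim w fun v => 1 - vertexWeight e w v

/-- Move along `z` until a further inequality becomes tight; the conditions on `z` keep the tight
ones tight. -/
theorem exists_slack_lt [Fintype V] (e : ι → Finset V) {w : ι → ℝ}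
    (hne : ∀ a, 0 < w a → (e a).Nonempty) (hw : IsFractionalMatching e w) {z : ι → ℝ}
    (hz : z ≠ 0) (hzw : ∀ a, w a = 0 → z a = 0)
    (hzv : ∀ v, vertexWeight e w v = 1 → vertexWeight e z v = 0) (hsum : 0 ≤ ∑ a, z a) :
    ∃ w', IsFractionalMatching e w' ∧ ∑ a, w a ≤ ∑ a, w' a ∧ (∀ a, w a = 0 → w' a = 0) ∧
      {k | 0 < matchingSlack e w' k}.ncard < {k | 0 < matchingSlack e w k}.ncard := by
  obtain ⟨t, ht, hnonneg, k₀, hk₀, hk₀'⟩ := exists_pos_ratio (matchingSlack e w)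
    (Sum.elim z fun v => -vertexWeight e z v)
    (by
      rintro (a | v)
      · exact hw.1 a
      · exact sub_nonneg.2 (hw.2 v))
    (by
      rintro (a | v) h
      · exact hzw a h
      · have : vertexWeight e w v = 1 := (sub_eq_zero.1 h).symm
        simp [hzv v this])
    (by
      -- If no slack decreased, `z` would be nonnegative with nonpositive total at every vertex,
      -- hence zero, as edges of positive weight are nonempty.
      by_contra! hcon
      apply hz
      funext a
      refine le_antisymm ?_ (hcon (Sum.inl a))
      rcases (hw.1 a).eq_or_lt with h0 | h0
      · exact (hzw a h0.symm).le
      obtain ⟨v, hv⟩ := hne a h0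
      have h1 := hcon (Sum.inr v)
      simp only [Sum.elim_inr, Left.nonneg_neg_iff] at h1
      refine le_trans ?_ h1
      have h2 := Finset.single_le_sum (f := fun a => if v ∈ e a then z a else 0)
        (fun b _ => by
          split_ifs
          · exact hcon (Sum.inl b)
          · exact le_rfl) (Finset.mem_univ a)
      rwa [if_pos hv] at h2)
  let w' : ι → ℝ := fun a => w a + t * z a
  have hslack : ∀ k, matchingSlack e w' k =
      matchingSlack e w k + t * Sum.elim z (fun v => -vertexWeight e z v) k := by
    rintro (a | v)
    · rfl
    · simp only [matchingSlack, Sum.elim_inr, w', vertexWeight_add_mul]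
      ring
  refine ⟨w', ⟨fun a => ?_, fun v => ?_⟩, ?_, fun a ha => ?_, ?_⟩
  · have := hnonneg (Sum.inl a)
    rwa [← hslack] at this
  · have := hnonneg (Sum.inr v)
    rw [← hslack] at this
    exact sub_nonneg.1 this
  · simp only [w', Finset.sum_add_distrib, ← Finset.mul_sum]
    have := mul_nonneg ht.le hsum
    linarith
  · simp only [w', ha, hzw a ha]; simp
  · apply Set.ncard_lt_ncard
    · refine ⟨fun k hk => ?_, fun hsub => ?_⟩
      · simp only [Set.mem_ofPred_eq] at hk ⊢
        rw [hslack] at hk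
        rcases k with a | v
        · refine (hw.1 a).lt_of_ne fun h => ?_
          have h' : matchingSlack e w (Sum.inl a) = 0 := h.symm
          rw [h', Sum.elim_inl, hzw a h.symm] at hk
          simp at hk
        · refine (sub_nonneg.2 (hw.2 v)).lt_of_ne fun h => ?_
          have h' : matchingSlack e w (Sum.inr v) = 0 := h.symm
          rw [h', Sum.elim_inr, hzv v (sub_eq_zero.1 h.symm).symm] at hk
          simp at hk
      · have := hsub hk₀
        simp only [Set.mem_ofPred_eq] at this
        rw [hslack, hk₀'] at this
        exact lt_irrefl _ this
    · exact Set.toFinite _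

/-- In a fractional matching with the fewest slack inequalities, the edges of positive weight are
independent at the saturated vertices. -/
theorem eq_zero_of_minimal_slack [Fintype V] (e : ι → Finset V) {w : ι → ℝ}
    (hne : ∀ a, 0 < w a → (e a).Nonempty) (hw : IsFractionalMatching e w)
    (hmin : ∀ w', IsFractionalMatching e w' → ∑ a, w a ≤ ∑ a, w' a → (∀ a, w a = 0 → w' a = 0) →
      {k | 0 < matchingSlack e w k}.ncard ≤ {k | 0 < matchingSlack e w' k}.ncard)
    {z : ι → ℝ} (hzw : ∀ a, w a = 0 → z a = 0)
    (hzv : ∀ v, vertexWeight e w v = 1 → vertexWeight e z v = 0) : z = 0 := by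
  by_contra hz
  rcases le_total 0 (∑ a, z a) with h | h
  · obtain ⟨w', h1, h2, h3, h4⟩ := exists_slack_lt e hne hw hz hzw hzv h
    exact absurd (hmin w' h1 h2 h3) (not_le.2 h4)
  · obtain ⟨w', h1, h2, h3, h4⟩ := exists_slack_lt e hne hw (z := fun a => (-1) * z a)
      (fun h' => hz (funext fun a => by have := congrFun h' a; simpa using this))
      (fun a ha => by simp [hzw a ha])
      (fun v hv => by rw [vertexWeight_const_mul, hzv v hv, mul_zero])
      (by simpa using h)
    exact absurd (hmin w' h1 h2 h3) (not_le.2 h4)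

/-- Otherwise each saturated vertex lies in at least d positive edges, and each of these has d
vertices. Independence gives at least as many saturated vertices as positive edges, so counting
incidences forces equality and the incidence map `A` is bijective. But each edge then has one
saturated vertex in every part, so every vector in the range of `A` has equal sums over all parts,
which a unit vector violates. -/
theorem exists_heavy_edge [Fintype V] [Nontrivial D] (part : V → D) (e : ι → Finset V)
    (hpart : ∀ a, Set.InjOn part (e a)) (w : ι → ℝ) (hw : IsFractionalMatching e w)
    (hind : ∀ z : ι → ℝ, (∀ a, w a = 0 → z a = 0) →
      (∀ v, vertexWeight e w v = 1 → vertexWeight e z v = 0) → z = 0)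
    (hpos : ∃ a, 0 < w a) :
    ∃ a, 0 < w a ∧ ((e a).card < Fintype.card D ∨ 1 ≤ (Fintype.card D - 1 : ℝ) * w a) := by
  classical
  by_contra! hcon
  set d := Fintype.card D with hd
  have hd2 : 2 ≤ d := Fintype.one_lt_card
  have hd1 : (0 : ℝ) < d - 1 := by
    have : (2 : ℝ) ≤ d := by exact_mod_cast hd2
    linarith
  have hcard : ∀ a, (e a).card ≤ d := fun a => by
    rw [← Finset.card_image_of_injOn (hpart a)]
    exact Finset.card_le_univ _
  let P : Finset ι := Finset.univ.filter fun a => 0 < w a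
  let S : Finset V := Finset.univ.filter fun v => vertexWeight e w v = 1
  have hP : ∀ a, a ∈ P ↔ 0 < w a := fun a => by simp [P]
  have hS : ∀ v, v ∈ S ↔ vertexWeight e w v = 1 := fun v => by simp [S]
  have hP0 : ∀ a, a ∉ P → w a = 0 := fun a ha =>
    le_antisymm (not_lt.1 fun h => ha ((hP a).2 h)) (hw.1 a)
  let ext : (P → ℝ) → ι → ℝ := fun z a => if h : a ∈ P then z ⟨a, h⟩ else 0
  have hext : ∀ z (a : P), ext z a = z a := fun z a => by simp [ext]
  have hextw : ∀ z v, vertexWeight e (ext z) v = ∑ a : P, if v ∈ e a then z a else 0 := by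
    intro z v
    rw [vertexWeight, ← Finset.sum_subset (Finset.subset_univ P), ← Finset.sum_coe_sort P]
    · exact Finset.sum_congr rfl fun a _ => by rw [hext]
    · intro a _ ha
      simp [ext, ha]
  let A : (P → ℝ) →ₗ[ℝ] (S → ℝ) := Matrix.toLin' (Matrix.of fun v a => if v.1 ∈ e a then 1 else 0)
  have hA : ∀ z v, A z v = ∑ a : P, if v.1 ∈ e a then z a else 0 := by
    intro z v
    simp [A, Matrix.mulVec, dotProduct]
  have hinj : Function.Injective A := by
    rw [← LinearMap.ker_eq_bot, LinearMap.ker_eq_bot']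
    intro z hz
    have h0 : ext z = 0 := by
      refine hind _ (fun a ha => ?_) fun v hv => ?_
      · have : a ∉ P := fun h => ((hP a).1 h).ne' ha
        simp [ext, this]
      · rw [hextw, ← hA z ⟨v, (hS v).2 hv⟩, hz]
        rfl
    funext a
    rw [← hext z a, h0]
    rfl
  have hPS : P.card ≤ S.card := by
    have := LinearMap.finrank_le_finrank_of_injective hinj
    simpa using this
  have hdeg : ∀ v ∈ S, d ≤ (P.filter fun a => v ∈ e a).card := by
    intro v hv
    by_contra! hlt
    have h1 : vertexWeight e w v = ∑ a ∈ P.filter fun a => v ∈ e a, w a := by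
      rw [vertexWeight, ← Finset.sum_filter]
      symm
      apply Finset.sum_subset
      · exact Finset.filter_subset_filter _ (Finset.subset_univ _)
      · intro a ha ha'
        exact hP0 a fun h => ha' (Finset.mem_filter.2 ⟨h, (Finset.mem_filter.1 ha).2⟩)
    rw [(hS v).1 hv] at h1
    have hne : (P.filter fun a => v ∈ e a).Nonempty := by
      by_contra h
      rw [Finset.not_nonempty_iff_eq_empty.1 h] at h1
      simp at h1
    have h2 : ∑ a ∈ P.filter (fun a => v ∈ e a), ((d : ℝ) - 1) * w a <
        ∑ a ∈ P.filter (fun a => v ∈ e a), 1 :=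
      Finset.sum_lt_sum_of_nonempty hne fun a ha =>
        (hcon a ((hP a).1 (Finset.mem_filter.1 ha).1)).2
    rw [← Finset.mul_sum, ← h1] at h2
    simp only [Finset.sum_const, nsmul_eq_mul, mul_one] at h2
    have h3 : ((P.filter fun a => v ∈ e a).card : ℝ) + 1 ≤ d := by exact_mod_cast hlt
    linarith
  have hdouble : ∑ v ∈ S, (P.filter fun a => v ∈ e a).card =
      ∑ a ∈ P, (S.filter fun v => v ∈ e a).card :=
    Finset.sum_card_bipartiteAbove_eq_sum_card_bipartiteBelow fun v a => v ∈ e a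
  have hSd : S.card * d ≤ ∑ v ∈ S, (P.filter fun a => v ∈ e a).card := by
    rw [← smul_eq_mul]
    exact Finset.card_nsmul_le_sum _ _ _ hdeg
  have hle : ∀ a, (S.filter fun v => v ∈ e a).card ≤ d := fun a =>
    (Finset.card_le_card fun v hv => (Finset.mem_filter.1 hv).2).trans (hcard a)
  have hPd : ∑ a ∈ P, (S.filter fun v => v ∈ e a).card ≤ ∑ a ∈ P, d :=
    Finset.sum_le_sum fun a _ => hle a
  have hPd' : ∑ a ∈ P, d = P.card * d := by simp
  have hmul : P.card * d ≤ S.card * d := Nat.mul_le_mul_right d hPS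
  have hcardeq : P.card = S.card :=
    Nat.eq_of_mul_eq_mul_right (by omega : 0 < d) (by omega)
  have hfull : ∀ a ∈ P, (S.filter fun v => v ∈ e a).card = d :=
    (Finset.sum_eq_sum_iff_of_le fun a _ => hle a).1 (by omega)
  have hone : ∀ a ∈ P, ∀ p : D, ∃ v ∈ S, v ∈ e a ∧ part v = p := by
    intro a ha p
    have : (S.filter fun v => v ∈ e a).image part = Finset.univ := by
      apply Finset.eq_univ_of_card
      rw [Finset.card_image_of_injOn, hfull a ha]
      exact fun x hx y hy => hpart a (Finset.mem_filter.1 hx).2 (Finset.mem_filter.1 hy).2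
    obtain ⟨v, hv, hvp⟩ := Finset.mem_image.1 (this ▸ Finset.mem_univ p)
    exact ⟨v, (Finset.mem_filter.1 hv).1, (Finset.mem_filter.1 hv).2, hvp⟩
  have hsurj : Function.Surjective A := by
    refine (LinearMap.injective_iff_surjective_of_finrank_eq_finrank ?_).1 hinj
    simpa using hcardeq
  have hpartsum : ∀ z p, ∑ v : S, (if part v.1 = p then A z v else 0) = ∑ a, z a := by
    intro z p
    have h1 : ∀ v : S, (if part v.1 = p then A z v else 0) =
        ∑ a : P, if part v.1 = p ∧ v.1 ∈ e a then z a else 0 := by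
      intro v
      rw [hA]
      by_cases h : part v.1 = p <;> simp [h]
    simp only [h1]
    rw [Finset.sum_comm]
    refine Finset.sum_congr rfl fun a _ => ?_
    obtain ⟨v, hvS, hva, hvp⟩ := hone a a.2 p
    rw [Finset.sum_eq_single ⟨v, hvS⟩]
    · simp [hva, hvp]
    · intro u _ hu
      rw [if_neg]
      rintro ⟨h1, h2⟩
      exact hu (Subtype.ext (hpart a h2 hva (h1.trans hvp.symm)))
    · exact fun h => absurd (Finset.mem_univ _) h
  obtain ⟨a₀, ha₀⟩ := hpos
  obtain ⟨p, q, hpq⟩ := exists_pair_ne D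
  obtain ⟨v₀, hv₀S, -, hv₀p⟩ := hone a₀ ((hP a₀).2 ha₀) p
  obtain ⟨z, hz⟩ := hsurj (Pi.single ⟨v₀, hv₀S⟩ 1)
  have h1 := hpartsum z p
  have h2 := hpartsum z q
  rw [← h2, hz] at h1
  rw [Finset.sum_eq_single ⟨v₀, hv₀S⟩ (fun u _ hu => by simp [Pi.single_eq_of_ne hu])
      (fun h => absurd (Finset.mem_univ _) h),
    Finset.sum_eq_single ⟨v₀, hv₀S⟩ (fun u _ hu => by simp [Pi.single_eq_of_ne hu])
      (fun h => absurd (Finset.mem_univ _) h)] at h1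
  simp [hv₀p, hpq] at h1

/-- Adding the vertex inequalities over `e a₀` counts every edge meeting it at least once, and `a₀`
itself once per vertex. -/
theorem sum_meeting_le (e : ι → Finset V) (w : ι → ℝ) (hw : IsFractionalMatching e w) (a₀ : ι)
    (hne : (e a₀).Nonempty) :
    (∑ a, if Disjoint (e a₀) (e a) then 0 else w a) ≤
      (e a₀).card - ((e a₀).card - 1) * w a₀ := by
  classical
  have h1 : ∑ v ∈ e a₀, vertexWeight e w v ≤ ∑ v ∈ e a₀, (1 : ℝ) :=
    Finset.sum_le_sum fun v _ => hw.2 v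
  have h2 : ∑ v ∈ e a₀, vertexWeight e w v = ∑ a, ((e a₀ ∩ e a).card : ℝ) * w a := by
    simp only [vertexWeight]
    rw [Finset.sum_comm]
    refine Finset.sum_congr rfl fun a _ => ?_
    rw [← Finset.sum_filter, Finset.filter_mem_eq_inter, Finset.sum_const, nsmul_eq_mul]
  have hle : ∀ a, (if Disjoint (e a₀) (e a) then 0 else w a) ≤ ((e a₀ ∩ e a).card : ℝ) * w a := by
    intro a
    split_ifs with h
    · exact mul_nonneg (Nat.cast_nonneg _) (hw.1 a)
    · have h3 : 1 ≤ (e a₀ ∩ e a).card := by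
        rw [Nat.one_le_iff_ne_zero, Finset.card_ne_zero]
        exact Finset.not_disjoint_iff_nonempty_inter.1 h
      have h4 : (1 : ℝ) ≤ (e a₀ ∩ e a).card := by exact_mod_cast h3
      have := hw.1 a
      nlinarith
  have hnd : ¬Disjoint (e a₀) (e a₀) := fun h => hne.ne_empty (by simpa using h)
  have h5 : (∑ a, if Disjoint (e a₀) (e a) then 0 else w a) + ((e a₀).card - 1) * w a₀ ≤
      ∑ a, ((e a₀ ∩ e a).card : ℝ) * w a := by
    rw [← Finset.add_sum_erase _ _ (Finset.mem_univ a₀),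
      ← Finset.add_sum_erase (a := a₀) _ (fun a => ((e a₀ ∩ e a).card : ℝ) * w a)
        (Finset.mem_univ a₀)]
    have := Finset.sum_le_sum fun a (_ : a ∈ Finset.univ.erase a₀) => hle a
    simp only [Finset.inter_self, if_neg hnd]
    linarith
  simp only [Finset.sum_const, nsmul_eq_mul, mul_one] at h1
  linarith

/-- Füredi's bound for multipartite hypergraphs: with `d` parts, a fractional matching exceeds some
matching, all of whose edges have positive weight, by a factor of at most `d - 1`. -/
theorem exists_matching_of_isFractionalMatching [Fintype V] [Nontrivial D] (part : V → D)
    (e : ι → Finset V) (hpart : ∀ a, Set.InjOn part (e a)) (w : ι → ℝ)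
    (hne : ∀ a, 0 < w a → (e a).Nonempty)
    (hw : IsFractionalMatching e w) :
    ∃ M : Finset ι, (∀ a ∈ M, 0 < w a) ∧ (∀ a ∈ M, ∀ b ∈ M, a ≠ b → Disjoint (e a) (e b)) ∧
      ∑ a, w a ≤ (Fintype.card D - 1 : ℝ) * M.card := by
  classical
  induction hn : {a | 0 < w a}.ncard using Nat.strong_induction_on generalizing w with
  | _ n ih =>
  subst hn
  -- Pass to a matching with fewest slack inequalities, without losing total or enlarging the
  -- support. Then pick a heavy edge, delete all edges meeting it, and recurse.
  obtain ⟨w₁, ⟨hw₁, hsum₁, hsupp₁⟩, hmin⟩ := WellFounded.has_min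
    (measure fun w' : ι → ℝ => {k | 0 < matchingSlack e w' k}.ncard).wf
    {w' | IsFractionalMatching e w' ∧ ∑ a, w a ≤ ∑ a, w' a ∧ ∀ a, w a = 0 → w' a = 0}
    ⟨w, hw, le_rfl, fun _ h => h⟩
  have hsupp : ∀ a, 0 < w₁ a → 0 < w a := fun a ha =>
    (hw.1 a).lt_of_ne fun h => ha.ne' (hsupp₁ a h.symm)
  by_cases hpos : ∃ a, 0 < w₁ a
  · obtain ⟨a₀, ha₀, hheavy⟩ := exists_heavy_edge part e hpart w₁ hw₁
      (fun z hz hz' => eq_zero_of_minimal_slack e (fun a ha => hne a (hsupp a ha)) hw₁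
        (fun w' h1 h2 h3 => not_lt.1 (hmin w' ⟨h1, hsum₁.trans h2, fun a ha => h3 a (hsupp₁ a ha)⟩)) hz hz') hpos
    let w₂ : ι → ℝ := fun a => if Disjoint (e a₀) (e a) then w₁ a else 0
    have hw₂le : ∀ a, w₂ a ≤ w₁ a := fun a => by
      simp only [w₂]
      split_ifs
      · exact le_rfl
      · exact hw₁.1 a
    have hw₂ : IsFractionalMatching e w₂ := by
      refine ⟨fun a => ?_, fun v => (Finset.sum_le_sum fun a _ => ?_).trans (hw₁.2 v)⟩
      · simp only [w₂]
        split_ifs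
        · exact hw₁.1 a
        · exact le_rfl
      · split_ifs
        · exact hw₂le a
        · exact le_rfl
    have hw₂pos : ∀ a, 0 < w₂ a → Disjoint (e a₀) (e a) := by
      intro a ha
      by_contra h
      simp [w₂, h] at ha
    have hne₀ := hne a₀ (hsupp a₀ ha₀)
    have hnd : ¬Disjoint (e a₀) (e a₀) := fun h => hne₀.ne_empty (by simpa using h)
    obtain ⟨M, hM1, hM2, hM3⟩ := ih _ (by
      apply Set.ncard_lt_ncard _ (Set.toFinite _)
      refine ⟨fun a ha => hsupp a (lt_of_lt_of_le ha (hw₂le a)), fun h => ?_⟩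
      exact hnd (hw₂pos a₀ (h (hsupp a₀ ha₀)))) w₂
      (fun a ha => hne a (hsupp a (ha.trans_le (hw₂le a)))) hw₂ rfl
    have ha₀M : a₀ ∉ M := fun h => hnd (hw₂pos a₀ (hM1 a₀ h))
    refine ⟨insert a₀ M, fun a ha => ?_, fun a ha b hb hab => ?_, ?_⟩
    · rcases Finset.mem_insert.1 ha with rfl | haM
      · exact hsupp _ ha₀
      · exact hsupp _ ((hM1 a haM).trans_le (hw₂le a))
    · rcases Finset.mem_insert.1 ha with rfl | haM <;>
        rcases Finset.mem_insert.1 hb with rfl | hbM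
      · exact absurd rfl hab
      · exact hw₂pos b (hM1 b hbM)
      · exact (hw₂pos a (hM1 a haM)).symm
      · exact hM2 a haM b hbM hab
    · have hmeet := sum_meeting_le e w₁ hw₁ a₀ hne₀
      have hsplit : ∑ a, w₁ a = ∑ a, w₂ a + ∑ a, if Disjoint (e a₀) (e a) then 0 else w₁ a := by
        rw [← Finset.sum_add_distrib]
        refine Finset.sum_congr rfl fun a _ => ?_
        simp only [w₂]
        split_ifs <;> simp
      rw [Finset.card_insert_of_notMem ha₀M]
      have hcard1 : (1 : ℝ) ≤ (e a₀).card := by exact_mod_cast hne₀.card_pos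
      -- The deletion costs at most d-1: either `a₀` has at most d-1 vertices, or the saving (d-1) ·
      -- `w₁ a₀` is at least one.
      have hbound : ((e a₀).card : ℝ) - ((e a₀).card - 1) * w₁ a₀ ≤ Fintype.card D - 1 := by
        have hle : (e a₀).card ≤ Fintype.card D := by
          rw [← Finset.card_image_of_injOn (hpart a₀)]
          exact Finset.card_le_univ _
        rcases hle.lt_or_eq with h | h
        · have h1 : ((e a₀).card : ℝ) + 1 ≤ Fintype.card D := by exact_mod_cast h
          nlinarith
        · rcases hheavy with h' | h'
          · omega
          · rw [h]; linarith
      push_cast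
      linarith
  · push Not at hpos
    refine ⟨∅, by simp, by simp, ?_⟩
    have : ∑ a, w₁ a ≤ 0 := Finset.sum_nonpos fun a _ => hpos a
    simpa using hsum₁.trans this

end Hypergraph

/-! ### Cutting the unit interval into pieces. -/

/-- The position of the `m`-th cut when an interval is divided into pieces of lengths `x`. -/
noncomputable def cutPoint {N : ℕ} (x : Fin N → ℝ) (m : ℕ) : ℝ :=
  ∑ j : Fin N, if (j : ℕ) < m then x j else 0

section CutPoint

variable {N : ℕ}

theorem continuous_cutPoint (m : ℕ) : Continuous fun x : Fin N → ℝ => cutPoint x m := by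
  refine continuous_finsetSum _ fun j _ => ?_
  split_ifs
  · exact continuous_apply j
  · exact continuous_const

theorem cutPoint_zero (x : Fin N → ℝ) : cutPoint x 0 = 0 := by simp [cutPoint]

theorem cutPoint_succ (x : Fin N → ℝ) (j : Fin N) :
    cutPoint x (j + 1) = cutPoint x j + x j := by
  have h : ∀ i : Fin N, (if (i : ℕ) < j + 1 then x i else 0) =
      (if (i : ℕ) < j then x i else 0) + if i = j then x i else 0 := by
    intro i
    rcases lt_trichotomy i j with h | h | h
    · have h' : (i : ℕ) < j := h
      simp [h', h.ne, Nat.lt_succ_of_lt h']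
    · simp [h]
    · have h' : (j : ℕ) < i := h
      simp [h.ne', not_lt.2 h'.le, not_lt.2 (Nat.succ_le_of_lt h')]
  simp only [cutPoint, h, Finset.sum_add_distrib]
  simp

theorem cutPoint_mono {x : Fin N → ℝ} (hx : ∀ j, 0 ≤ x j) : Monotone (cutPoint x) := by
  intro m n hmn
  refine Finset.sum_le_sum fun j _ => ?_
  split_ifs with h1 h2
  · exact le_rfl
  · omega
  · exact hx j
  · exact le_rfl

theorem cutPoint_self {x : Fin N → ℝ} (hx : x ∈ stdSimplex ℝ (Fin N)) : cutPoint x N = 1 := by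
  rw [← hx.2]
  exact Finset.sum_congr rfl fun j _ => if_pos j.2

theorem cutPoint_mem_Icc {x : Fin N → ℝ} (hx : x ∈ stdSimplex ℝ (Fin N)) (m : ℕ) :
    cutPoint x m ∈ Set.Icc (0 : ℝ) 1 := by
  constructor
  · rw [← cutPoint_zero x]
    exact cutPoint_mono hx.1 (Nat.zero_le m)
  · rw [← hx.2]
    refine Finset.sum_le_sum fun j _ => ?_
    split_ifs
    · exact le_rfl
    · exact hx.1 j

/-- How far inside the `j`-th piece the interval `[l, u]` lies, and zero if it is not inside. -/
noncomputable def pieceDepth (x : Fin N → ℝ) (l u : ℝ) (j : Fin N) : ℝ :=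
  max 0 (min (l - cutPoint x j) (cutPoint x (j + 1) - u))

theorem continuous_pieceDepth (l u : ℝ) (j : Fin N) :
    Continuous fun x : Fin N → ℝ => pieceDepth x l u j :=
  continuous_const.max ((continuous_const.sub (continuous_cutPoint _)).min
    ((continuous_cutPoint _).sub continuous_const))

theorem pieceDepth_nonneg (x : Fin N → ℝ) (l u : ℝ) (j : Fin N) : 0 ≤ pieceDepth x l u j :=
  le_max_left _ _

theorem pieceDepth_pos_iff {x : Fin N → ℝ} {l u : ℝ} {j : Fin N} :
    0 < pieceDepth x l u j ↔ cutPoint x j < l ∧ u < cutPoint x (j + 1) := by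
  simp [pieceDepth]

theorem pieceDepth_eq_zero {x : Fin N → ℝ} {l u : ℝ} (hlu : l ≤ u) {j : Fin N} (hj : x j = 0) :
    pieceDepth x l u j = 0 := by
  by_contra h
  have h' := pieceDepth_pos_iff.1 ((pieceDepth_nonneg x l u j).lt_of_ne (Ne.symm h))
  rw [cutPoint_succ, hj] at h'
  linarith [h'.1, h'.2]

/-- Applied to one interval, this makes its piece unique; applied to two, it puts overlapping
intervals into the same piece. -/
theorem eq_of_pieceDepth_pos {x : Fin N → ℝ} (hx : ∀ j, 0 ≤ x j) {l u l' u' : ℝ}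
    (h : l' ≤ u) (h' : l ≤ u') {j j' : Fin N} (hj : 0 < pieceDepth x l u j)
    (hj' : 0 < pieceDepth x l' u' j') : j = j' := by
  rw [pieceDepth_pos_iff] at hj hj'
  rcases lt_trichotomy j j' with hlt | heq | hlt
  · have := cutPoint_mono hx (Nat.succ_le_of_lt (Fin.lt_def.1 hlt))
    simp only [Nat.succ_eq_add_one] at this
    linarith [hj.2, hj'.1]
  · exact heq
  · have := cutPoint_mono hx (Nat.succ_le_of_lt (Fin.lt_def.1 hlt))
    simp only [Nat.succ_eq_add_one] at this
    linarith [hj'.2, hj.1]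

/-- The cuts at 0 and 1 miss `[l, u]` automatically, so only the `k` inner ones have to be avoided.
-/
theorem exists_pieceDepth_pos {k : ℕ} {x : Fin (k + 1) → ℝ}
    (hx : x ∈ stdSimplex ℝ (Fin (k + 1))) {l u : ℝ} (hl : 0 < l) (hlu : l ≤ u) (hu : u < 1)
    (hcut : ∀ j : Fin k, cutPoint x (j + 1) ∉ Set.Icc l u) : ∃ j, 0 < pieceDepth x l u j := by
  classical
  have hex : ∃ m, u < cutPoint x m := ⟨k + 1, by rwa [cutPoint_self hx]⟩
  obtain ⟨j, hj⟩ : ∃ j, Nat.find hex = j + 1 := by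
    refine Nat.exists_eq_succ_of_ne_zero fun h => ?_
    have := Nat.find_spec hex
    rw [h, cutPoint_zero] at this
    linarith
  have hjk : j < k + 1 := by
    have := Nat.find_min' hex (m := k + 1) (by rwa [cutPoint_self hx])
    omega
  have h1 : u < cutPoint x (j + 1) := hj ▸ Nat.find_spec hex
  have h2 : cutPoint x j ≤ u := not_lt.1 (Nat.find_min hex (by omega))
  refine ⟨⟨j, hjk⟩, pieceDepth_pos_iff.2 ⟨?_, h1⟩⟩
  rcases j with _ | j
  · simpa [cutPoint_zero] using hl
  · by_contra hcon
    exact hcut ⟨j, by omega⟩ ⟨not_lt.1 hcon, h2⟩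

end CutPoint

/-! ### Piercing finite families, and all families by compactness. -/

/-- The finite case, in coordinates: `a` has components `[l a i, u a i]` for `i ∈ s a`. -/
theorem exists_piercing_of_finite {d : ℕ} (hd : 2 ≤ d) (n : ℕ) {ι : Type*} [Fintype ι]
    (s : ι → Finset (Fin d)) (hs : ∀ a, (s a).Nonempty) (l u : ι → Fin d → ℝ)
    (hl : ∀ a i, 0 < l a i) (hlu : ∀ a i, l a i ≤ u a i) (hu : ∀ a i, u a i < 1)
    (hn : ∀ M : Finset ι, (∀ a ∈ M, ∀ b ∈ M, a ≠ b → ∀ i ∈ s a, i ∈ s b →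
      u a i < l b i ∨ u b i < l a i) → M.card ≤ n) :
    ∃ t : Fin d → Fin ((d - 1) * n) → ℝ, (∀ i j, t i j ∈ Set.Icc (0 : ℝ) 1) ∧
      ∀ a, ∃ i ∈ s a, ∃ j, t i j ∈ Set.Icc (l a i) (u a i) := by
  classical
  have : Nontrivial (Fin d) := Fin.nontrivial_iff_two_le.2 hd
  set k := (d - 1) * n with hk
  let q : (Fin d → Fin (k + 1) → ℝ) → ι → Fin d → Fin (k + 1) → ℝ := fun x a i j =>
    pieceDepth (x i) (l a i) (u a i) j
  let Q : (Fin d → Fin (k + 1) → ℝ) → ι → Fin d → ℝ := fun x a i => ∑ j, q x a i j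
  let w : (Fin d → Fin (k + 1) → ℝ) → ι → ℝ := fun x a => ∏ i ∈ s a, Q x a i
  -- The product form makes continuity evident. Since `q x a i j` is nonzero for at most one `j`,
  -- this is the total of `w x` over the edges through piece (i, j).
  let W : (Fin d → Fin (k + 1) → ℝ) → Fin d → Fin (k + 1) → ℝ := fun x i j =>
    ∑ a, if i ∈ s a then q x a i j * ∏ i' ∈ (s a).erase i, Q x a i' else 0
  have hq0 : ∀ x a i j, 0 ≤ q x a i j := fun x a i j => pieceDepth_nonneg _ _ _ _
  have hQ0 : ∀ x a i, 0 ≤ Q x a i := fun x a i => Finset.sum_nonneg fun j _ => hq0 x a i j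
  have hw0 : ∀ x a, 0 ≤ w x a := fun x a => Finset.prod_nonneg fun i _ => hQ0 x a i
  have hqc : ∀ a i j, Continuous fun x => q x a i j := fun a i j =>
    (continuous_pieceDepth _ _ j).comp (continuous_apply i)
  have hQc : ∀ a i, Continuous fun x => Q x a i := fun a i =>
    continuous_finsetSum _ fun j _ => hqc a i j
  obtain ⟨x, hx, hWx⟩ := exists_equalized_weights hd k.succ_pos W
    (continuous_pi fun i => continuous_pi fun j => continuous_finsetSum _ fun a _ => by
      by_cases h : i ∈ s a
      · simp only [if_pos h]
        exact (hqc a i j).mul (continuous_finsetProd _ fun i' _ => hQc a i')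
      · simp only [if_neg h]
        exact continuous_const)
    (fun x i j => Finset.sum_nonneg fun a _ => by
      split_ifs
      · exact mul_nonneg (hq0 x a i j) (Finset.prod_nonneg fun i' _ => hQ0 x a i')
      · exact le_rfl)
    (fun x hx i j hij => Finset.sum_eq_zero fun a _ => by
      have : q x a i j = 0 := pieceDepth_eq_zero (hlu a i) hij
      simp [this])
  by_contra hno
  obtain ⟨a₀, ha₀⟩ : ∃ a, ∀ i ∈ s a, ∀ j : Fin k,
      cutPoint (x i) (j + 1) ∉ Set.Icc (l a i) (u a i) := by
    by_contra! hcon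
    exact hno ⟨fun i j => cutPoint (x i) (j + 1), fun i j => cutPoint_mem_Icc (hx i) _, hcon⟩
  have hQpos : ∀ a i, 0 < Q x a i ↔ ∃ j, 0 < q x a i j := by
    intro a i
    constructor
    · intro h
      by_contra! hcon
      exact h.not_ge (Finset.sum_nonpos fun j _ => hcon j)
    · rintro ⟨j, hj⟩
      exact Finset.sum_pos' (fun j _ => hq0 x a i j) ⟨j, Finset.mem_univ _, hj⟩
  have hwpos : ∀ a, 0 < w x a ↔ ∀ i ∈ s a, ∃ j, 0 < q x a i j := by
    intro a
    constructor
    · intro h i hi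
      rw [← hQpos]
      refine (hQ0 x a i).lt_of_ne fun h0 => h.ne' ?_
      exact Finset.prod_eq_zero hi h0.symm
    · intro h
      exact Finset.prod_pos fun i hi => (hQpos a i).2 (h i hi)
  have huniq : ∀ a i j j', 0 < q x a i j → 0 < q x a i j' → j = j' := fun a i j j' hj hj' =>
    eq_of_pieceDepth_pos (hx i).1 (hlu a i) (hlu a i) hj hj'
  let e : ι → Finset (Fin d × Fin (k + 1)) := fun a =>
    Finset.univ.filter fun p => p.1 ∈ s a ∧ 0 < q x a p.1 p.2
  have he : ∀ a p, p ∈ e a ↔ p.1 ∈ s a ∧ 0 < q x a p.1 p.2 := fun a p => by simp [e]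
  have hinj : ∀ a, Set.InjOn Prod.fst (e a : Set (Fin d × Fin (k + 1))) := by
    rintro a ⟨i, j⟩ hp ⟨i', j'⟩ hp' (rfl : i = i')
    rw [huniq a i j j' ((he a _).1 hp).2 ((he a _).1 hp').2]
  have hW : ∀ p, W x p.1 p.2 = vertexWeight e (w x) p := by
    rintro ⟨i, j⟩
    refine Finset.sum_congr rfl fun a _ => ?_
    by_cases hi : i ∈ s a
    · rcases (hq0 x a i j).eq_or_lt with h | h
      · rw [if_pos hi, ← h, zero_mul, if_neg]
        exact fun h' => h.not_lt ((he a _).1 h').2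
      · rw [if_pos hi, if_pos ((he a _).2 ⟨hi, h⟩)]
        have : Q x a i = q x a i j := by
          refine Finset.sum_eq_single j (fun j' _ hj' => ?_) fun h' => absurd (Finset.mem_univ _) h'
          exact ((hq0 x a i j').eq_or_lt.resolve_right fun h' => hj' (huniq a i j' j h' h)).symm
        rw [← this]
        exact Finset.mul_prod_erase (s a) (Q x a) hi
    · rw [if_neg hi, if_neg]
      exact fun h' => hi ((he a _).1 h').1
  have hne : ∀ a, 0 < w x a → (e a).Nonempty := by
    intro a ha
    obtain ⟨i, hi⟩ := hs a
    obtain ⟨j, hj⟩ := (hwpos a).1 ha i hi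
    exact ⟨(i, j), (he a _).2 ⟨hi, hj⟩⟩
  have hwa₀ : 0 < w x a₀ := (hwpos a₀).2 fun i hi =>
    exists_pieceDepth_pos (hx i) (hl a₀ i) (hlu a₀ i) (hu a₀ i) (ha₀ i hi)
  obtain ⟨i₀, hi₀⟩ := Finite.exists_max fun i => W x i 0
  set c := W x i₀ 0 with hc
  have hWc : ∀ p, vertexWeight e (w x) p ≤ c := fun p => by
    rw [← hW, hWx p.1 p.2 0]
    exact hi₀ p.1
  have hcpos : 0 < c := by
    obtain ⟨p, hp⟩ := hne a₀ hwa₀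
    refine lt_of_lt_of_le ?_ (hWc p)
    refine Finset.sum_pos' (fun a _ => ?_) ⟨a₀, Finset.mem_univ _, by rwa [if_pos hp]⟩
    split_ifs
    · exact hw0 x a
    · exact le_rfl
  -- On segment `i₀` all k + 1 pieces have weight `c`, and each member is counted in at most one of
  -- them.
  have htotal : (k + 1 : ℝ) * c ≤ ∑ a, w x a := by
    have h1 : ∑ j, W x i₀ j = (k + 1 : ℝ) * c := by
      simp only [hWx i₀ _ 0, ← hc, Finset.sum_const, Finset.card_univ, Fintype.card_fin,
        nsmul_eq_mul]
      push_cast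
      ring
    rw [← h1]
    simp only [fun j => hW (i₀, j), vertexWeight]
    rw [Finset.sum_comm]
    refine Finset.sum_le_sum fun a _ => ?_
    by_cases h : ∃ j, (i₀, j) ∈ e a
    · obtain ⟨j, hj⟩ := h
      rw [Finset.sum_eq_single j, if_pos hj]
      · intro j' _ hj'
        rw [if_neg]
        exact fun h' => hj' (huniq a i₀ j' j ((he a _).1 h').2 ((he a _).1 hj).2)
      · exact fun h => absurd (Finset.mem_univ _) h
    · push Not at h
      rw [Finset.sum_eq_zero fun j _ => if_neg (h j)]
      exact hw0 x a
  obtain ⟨M, hM1, hM2, hM3⟩ := exists_matching_of_isFractionalMatching Prod.fst e hinj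
    (fun a => c⁻¹ * w x a)
    (fun a ha => hne a ((mul_pos_iff_of_pos_left (inv_pos.2 hcpos)).1 ha))
    ⟨fun a => mul_nonneg (inv_pos.2 hcpos).le (hw0 x a), fun p => by
      rw [vertexWeight_const_mul, inv_mul_le_iff₀ hcpos, mul_one]
      exact hWc p⟩
  have hMn : M.card ≤ n := by
    refine hn M fun a ha b hb hab i hia hib => ?_
    by_contra! hcon
    have hpos : ∀ a ∈ M, 0 < w x a := fun a ha =>
      (mul_pos_iff_of_pos_left (inv_pos.2 hcpos)).1 (hM1 a ha)
    obtain ⟨j, hj⟩ := (hwpos a).1 (hpos a ha) i hia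
    obtain ⟨j', hj'⟩ := (hwpos b).1 (hpos b hb) i hib
    have := eq_of_pieceDepth_pos (hx i).1 hcon.1 hcon.2 hj hj'
    subst this
    exact Finset.disjoint_left.1 (hM2 a ha b hb hab) ((he a (i, j)).2 ⟨hia, hj⟩)
      ((he b (i, j)).2 ⟨hib, hj'⟩)
  simp only [Fintype.card_fin] at hM3
  rw [← Finset.mul_sum] at hM3
  have h1 : (k + 1 : ℝ) ≤ c⁻¹ * ∑ a, w x a := by
    rw [le_inv_mul_iff₀ hcpos]
    linarith
  have hd1 : ((d - 1 : ℕ) : ℝ) = (d : ℝ) - 1 := by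
    rw [Nat.cast_sub (by omega)]
    simp
  have h2 : ((k + 1 : ℕ) : ℝ) ≤ (((d - 1) * M.card : ℕ) : ℝ) := by
    push_cast
    rw [hd1]
    exact h1.trans hM3
  have h3 : k + 1 ≤ (d - 1) * M.card := by exact_mod_cast h2
  have h4 := Nat.mul_le_mul_left (d - 1) hMn
  omega

/-- Positions in [0, 1] form a compact space and meeting a given member is a closed condition, so
finite subfamilies decide. -/
theorem exists_piercing {d : ℕ} (hd : 2 ≤ d) (n : ℕ) {ι : Type*}
    (s : ι → Finset (Fin d)) (hs : ∀ a, (s a).Nonempty) (l u : ι → Fin d → ℝ)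
    (hl : ∀ a i, 0 < l a i) (hlu : ∀ a i, l a i ≤ u a i) (hu : ∀ a i, u a i < 1)
    (hn : ∀ M : Finset ι, (∀ a ∈ M, ∀ b ∈ M, a ≠ b → ∀ i ∈ s a, i ∈ s b →
      u a i < l b i ∨ u b i < l a i) → M.card ≤ n) :
    ∃ t : Fin d → Fin ((d - 1) * n) → ℝ,
      ∀ a, ∃ i ∈ s a, ∃ j, t i j ∈ Set.Icc (l a i) (u a i) := by
  classical
  let K : Set (Fin d → Fin ((d - 1) * n) → ℝ) :=
    Set.univ.pi fun _ => Set.univ.pi fun _ => Set.Icc (0 : ℝ) 1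
  have hK : IsCompact K := isCompact_univ_pi fun _ => isCompact_univ_pi fun _ => isCompact_Icc
  let C : ι → Set (Fin d → Fin ((d - 1) * n) → ℝ) := fun a =>
    ⋃ i ∈ s a, ⋃ j, {t | t i j ∈ Set.Icc (l a i) (u a i)}
  have hC : ∀ a, IsClosed (C a) := fun a =>
    (s a).finite_toSet.isClosed_biUnion fun i _ => isClosed_iUnion_of_finite fun j =>
      isClosed_Icc.preimage (continuous_apply_apply i j)
  have hCmem : ∀ a t, t ∈ C a ↔ ∃ i ∈ s a, ∃ j, t i j ∈ Set.Icc (l a i) (u a i) := by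
    intro a t
    simp [C]
  obtain ⟨t, -, ht⟩ := hK.inter_iInter_nonempty C hC (by
    intro A
    obtain ⟨t, ht1, ht2⟩ := exists_piercing_of_finite hd n (ι := A) (fun a => s a) (fun a => hs a)
      (fun a => l a) (fun a => u a) (fun a => hl a) (fun a => hlu a) (fun a => hu a)
      (by
        intro M hM
        rw [← Finset.card_map (Function.Embedding.subtype _)]
        apply hn
        intro a ha b hb hab
        obtain ⟨a, haM, rfl⟩ := Finset.mem_map.1 ha
        obtain ⟨b, hbM, rfl⟩ := Finset.mem_map.1 hb
        exact hM a haM b hbM fun h => hab (by rw [h]))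
    refine ⟨t, fun i _ j _ => ht1 i j, Set.mem_iInter₂.2 fun a ha => (hCmem a t).2 ?_⟩
    exact ht2 ⟨a, ha⟩)
  exact ⟨t, fun a => (hCmem a t).1 (Set.mem_iInter.1 ht a)⟩

/-! ### Transfer to the plane, and infinite packing numbers. -/

theorem mk_le_packingNumber {X : Type*} {S M : Set (Set X)} (hM : IsMatchingIn S M) :
    #M ≤ packingNumber S :=
  le_ciSup (f := fun M : {M : Set (Set X) // IsMatchingIn S M} => #M.1)
    Cardinal.bddAbove_of_small ⟨M, hM⟩

theorem exists_matching_meeting {X : Type*} (S : Set (Set X)) (hS : ∀ A ∈ S, A.Nonempty) :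
    ∃ M, IsMatchingIn S M ∧ ∀ A ∈ S, (A ∩ ⋃₀ M).Nonempty := by
  obtain ⟨M, hM⟩ := zorn_subset {M | IsMatchingIn S M} (by
    intro c hc hchain
    refine ⟨⋃₀ c, ⟨Set.sUnion_subset fun M hM => (hc hM).1, ?_⟩, fun M hM =>
      Set.subset_sUnion_of_mem hM⟩
    rintro A ⟨M, hM, hA⟩ B ⟨M', hM', hB⟩ hAB
    rcases hchain.total hM hM' with h | h
    · exact (hc hM').2 A (h hA) B hB hAB
    · exact (hc hM).2 A hA B (h hB) hAB)
  refine ⟨M, hM.prop, fun A hA => ?_⟩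
  by_contra hempty
  have hdisj : ∀ B ∈ M, A ∩ B = ∅ := by
    intro B hB
    by_contra h
    obtain ⟨x, hxA, hxB⟩ := Set.nonempty_iff_ne_empty.2 h
    exact hempty ⟨x, hxA, B, hB, hxB⟩
  have hins : IsMatchingIn S (insert A M) := by
    refine ⟨Set.insert_subset hA hM.prop.1, ?_⟩
    rintro B (rfl | hB) B' (rfl | hB') hne
    · exact absurd rfl hne
    · exact hdisj B' hB'
    · rw [Set.inter_comm]
      exact hdisj B hB
    · exact hM.prop.2 B hB B' hB' hne
  have hAM : A ∈ M := hM.le_of_ge hins (Set.subset_insert A M) (Set.mem_insert A M)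
  obtain ⟨x, hx⟩ := hS A hA
  exact hempty ⟨x, hx, A, hAM, hx⟩

/-- Parallel unit segments are parametrized by the middle third of the unit interval. -/
theorem exists_parametrization {d : ℕ} {I : Fin d → Set Plane}
    (hI : AreDisjointParallelUnitSegments I) :
    ∃ φ : Fin d → ℝ → Plane, (∀ i, Function.Injective (φ i)) ∧
      ∀ J, IsDInterval I J → ∀ i, (J ∩ I i).Nonempty →
        ∃ l u, 0 < l ∧ l ≤ u ∧ u < 1 ∧ J ∩ I i = φ i '' Set.Icc l u := by
  obtain ⟨⟨v, hv, hp⟩, -⟩ := hI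
  choose p hp using hp
  have hv0 : v ≠ 0 := by
    rintro rfl
    simp at hv
  -- Extending each segment by its own length on both sides keeps the parameters of all components
  -- strictly between 0 and 1.
  let φ : Fin d → ℝ →ᵃ[ℝ] Plane := fun i => AffineMap.lineMap (p i - v) (p i + (2 : ℝ) • v)
  have hφ : ∀ i τ, φ i τ = p i + (3 * τ - 1) • v := by
    intro i τ
    simp only [φ, AffineMap.lineMap_apply, vsub_eq_sub, vadd_eq_add]
    module
  have hIφ : ∀ i, I i = φ i '' Set.Icc (1 / 3) (2 / 3) := by
    intro i
    rw [hp, ← Set.uIcc_of_le (by norm_num), ← segment_eq_uIcc, image_segment, hφ, hφ]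
    norm_num
  refine ⟨fun i => φ i, fun i τ τ' h => ?_, fun J hJ i hne => ?_⟩
  · simp only [hφ] at h
    have := smul_left_injective ℝ hv0 (add_left_cancel h)
    linarith
  · rcases hJ.2.2 i with h | ⟨a, b, hab⟩
    · exact absurd h hne.ne_empty
    have haI : a ∈ I i := (hab ▸ left_mem_segment ℝ a b : a ∈ J ∩ I i).2
    have hbI : b ∈ I i := (hab ▸ right_mem_segment ℝ a b : b ∈ J ∩ I i).2
    rw [hIφ] at haI hbI
    obtain ⟨α, hα, rfl⟩ := haI
    obtain ⟨β, hβ, rfl⟩ := hbI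
    refine ⟨min α β, max α β, lt_min ?_ ?_, min_le_max, max_lt ?_ ?_, ?_⟩
    · linarith [hα.1]
    · linarith [hβ.1]
    · linarith [hα.2]
    · linarith [hβ.2]
    · rw [hab, ← image_segment, segment_eq_uIcc]
      rfl

/-- Kaiser's transversal theorem when the packing number is finite. -/
theorem exists_transversal_of_packingNumber_eq_nat {d : ℕ} (hd : 2 ≤ d) {I : Fin d → Set Plane}
    (hI : AreDisjointParallelUnitSegments I) {F : Set (Set Plane)}
    (hF : ∀ J ∈ F, IsDInterval I J) {n : ℕ} (hn : packingNumber F = n) :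
    ∃ T : Set Plane, IsTransversal (⋃ i, I i) F T ∧ #T ≤ ((d ^ 2 - d : ℕ) : Cardinal) * n := by
  classical
  obtain ⟨φ, hφ, hJφ⟩ := exists_parametrization hI
  let s : F → Finset (Fin d) := fun J => Finset.univ.filter fun i => (J.1 ∩ I i).Nonempty
  have hs : ∀ J i, i ∈ s J ↔ (J.1 ∩ I i).Nonempty := fun J i => by simp [s]
  have hex : ∀ (J : F) i, ∃ l u, 0 < l ∧ l ≤ u ∧ u < 1 ∧
      (i ∈ s J → J.1 ∩ I i = φ i '' Set.Icc l u) := by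
    intro J i
    by_cases h : i ∈ s J
    · obtain ⟨l, u, h1, h2, h3, h4⟩ := hJφ J.1 (hF J J.2) i ((hs J i).1 h)
      exact ⟨l, u, h1, h2, h3, fun _ => h4⟩
    · exact ⟨1 / 2, 1 / 2, by norm_num, le_rfl, by norm_num, fun h' => absurd h' h⟩
  choose l u hl hlu hu hcomp using hex
  have hmem : ∀ (J : F) x, x ∈ J.1 → ∃ i ∈ s J, x ∈ J.1 ∩ I i := by
    intro J x hx
    obtain ⟨i, hi⟩ := Set.mem_iUnion.1 ((hF J J.2).1 hx)
    exact ⟨i, (hs J i).2 ⟨x, hx, hi⟩, hx, hi⟩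
  obtain ⟨t, ht⟩ := exists_piercing hd n s
    (fun J => by
      obtain ⟨x, hx⟩ := (hF J J.2).2.1
      obtain ⟨i, hi, -⟩ := hmem J x hx
      exact ⟨i, hi⟩) l u hl hlu hu
    (by
      intro M hM
      have hmatch : IsMatchingIn F (M.map (Function.Embedding.subtype _) : Finset (Set Plane)) := by
        constructor
        · intro A hA
          obtain ⟨J, -, rfl⟩ := Finset.mem_map.1 (Finset.mem_coe.1 hA)
          exact J.2
        · intro A hA B hB hAB
          obtain ⟨J, hJ, rfl⟩ := Finset.mem_map.1 (Finset.mem_coe.1 hA)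
          obtain ⟨J', hJ', rfl⟩ := Finset.mem_map.1 (Finset.mem_coe.1 hB)
          rw [Set.eq_empty_iff_forall_notMem]
          rintro x ⟨hx, hx'⟩
          obtain ⟨i, hi, hxi⟩ := hmem J x hx
          have hi' : i ∈ s J' := (hs J' i).2 ⟨x, hx', hxi.2⟩
          have hxi' : x ∈ J'.1 ∩ I i := ⟨hx', hxi.2⟩
          rw [hcomp J i hi] at hxi
          rw [hcomp J' i hi'] at hxi'
          obtain ⟨τ, hτ, rfl⟩ := hxi
          obtain ⟨τ', hτ', h⟩ := hxi'
          obtain rfl := hφ i h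
          rcases hM J hJ J' hJ' (fun h => hAB (by rw [h])) i hi hi' with h | h
          · linarith [hτ.2, hτ'.1]
          · linarith [hτ.1, hτ'.2]
      have := mk_le_packingNumber hmatch
      rw [hn, Finset.coe_sort_coe, Cardinal.mk_coe_finset, Finset.card_map] at this
      exact_mod_cast this)
  -- Cuts may fall on the added parts of the extended segments, so the points outside the original
  -- ones are discarded.
  refine ⟨Set.range (fun p : Fin d × Fin ((d - 1) * n) => φ p.1 (t p.1 p.2)) ∩ ⋃ i, I i,
    ⟨Set.inter_subset_right, fun J hJ => ?_⟩, ?_⟩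
  · obtain ⟨i, hi, j, hj⟩ := ht ⟨J, hJ⟩
    have : φ i (t i j) ∈ J ∩ I i := by
      rw [hcomp ⟨J, hJ⟩ i hi]
      exact Set.mem_image_of_mem _ hj
    exact ⟨_, this.1, ⟨(i, j), rfl⟩, Set.mem_iUnion.2 ⟨i, this.2⟩⟩
  · refine (Cardinal.mk_le_mk_of_subset Set.inter_subset_left).trans ?_
    have h : #(Fin d × Fin ((d - 1) * n)) = ((d ^ 2 - d : ℕ) : Cardinal) * n := by
      rw [Cardinal.mk_fintype, Fintype.card_prod, Fintype.card_fin, Fintype.card_fin,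
        ← Nat.cast_mul, ← mul_assoc, Nat.mul_sub, mul_one, pow_two]
    rw [← h]
    have := Cardinal.mk_range_le_lift (f := fun p : Fin d × Fin ((d - 1) * n) => φ p.1 (t p.1 p.2))
    simpa using this

/-- When the packing number is infinite, a countable set meets the members with a nondegenerate
component, and a maximal matching takes care of the countable ones. -/
theorem exists_transversal_of_aleph0_le {d : ℕ} {I : Fin d → Set Plane}
    (hI : AreDisjointParallelUnitSegments I) {F : Set (Set Plane)}
    (hF : ∀ J ∈ F, IsDInterval I J) (hinf : ℵ₀ ≤ packingNumber F) :
    ∃ T : Set Plane, IsTransversal (⋃ i, I i) F T ∧ #T ≤ packingNumber F := by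
  obtain ⟨φ, -, hJφ⟩ := exists_parametrization hI
  let R : Set Plane := Set.range fun p : Fin d × ℚ => φ p.1 p.2
  have hR : R.Countable := Set.countable_range _
  let F' : Set (Set Plane) := {J ∈ F | J.Countable}
  have hF' : ∀ J ∈ F, J ∉ F' → (J ∩ R).Nonempty := by
    intro J hJ hJF'
    -- A member without points of rational parameter has only one-point components, hence is
    -- countable.
    by_contra hJR
    refine hJF' ⟨hJ, ?_⟩
    have hJeq : J = ⋃ i, J ∩ I i := by
      rw [← Set.inter_iUnion]
      exact (Set.inter_eq_left.2 (hF J hJ).1).symm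
    rw [hJeq]
    refine Set.countable_iUnion fun i => ?_
    rcases (J ∩ I i).eq_empty_or_nonempty with h | h
    · rw [h]
      exact Set.countable_empty
    · obtain ⟨l, u, -, hlu, -, heq⟩ := hJφ J (hF J hJ) i h
      rcases hlu.eq_or_lt with rfl | hlt
      · rw [heq, Set.Icc_self, Set.image_singleton]
        exact Set.countable_singleton _
      · obtain ⟨q, hq1, hq2⟩ := exists_rat_btwn hlt
        have : φ i q ∈ J ∩ I i := heq ▸ Set.mem_image_of_mem _ ⟨hq1.le, hq2.le⟩
        exact absurd ⟨_, this.1, (i, q), rfl⟩ hJR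
  obtain ⟨M, hM, hMmeet⟩ := exists_matching_meeting F' fun J hJ => (hF J hJ.1).2.1
  refine ⟨R ∩ (⋃ i, I i) ∪ ⋃₀ M, ⟨?_, fun J hJ => ?_⟩, ?_⟩
  · exact Set.union_subset Set.inter_subset_right
      (Set.sUnion_subset fun J hJ => (hF J (hM.1 hJ).1).1)
  · by_cases h : J ∈ F'
    · obtain ⟨x, hx1, hx2⟩ := hMmeet J h
      exact ⟨x, hx1, Or.inr hx2⟩
    · obtain ⟨x, hx1, hx2⟩ := hF' J hJ h
      exact ⟨x, hx1, Or.inl ⟨hx2, (hF J hJ).1 hx1⟩⟩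
  · refine (Cardinal.mk_union_le _ _).trans (Cardinal.add_le_of_le hinf ?_ ?_)
    · exact ((hR.mono Set.inter_subset_left).le_aleph0).trans hinf
    · refine (Cardinal.mk_sUnion_le M).trans (Cardinal.mul_le_of_le hinf ?_ ?_)
      · exact mk_le_packingNumber ⟨fun J hJ => (hM.1 hJ).1, hM.2⟩
      · exact (ciSup_le' fun J : M => (hM.1 J.2).2.le_aleph0).trans hinf

theorem theoremt (d : ℕ) (hd : 2 ≤ d) (I : Fin d → Set Plane)
    (hI : AreDisjointParallelUnitSegments I)
    (F : Set (Set Plane)) (hF : ∀ J ∈ F, IsDInterval I J) :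
    ∃ T : Set Plane, IsTransversal (⋃ i, I i) F T ∧
      #T ≤ ((d ^ 2 - d : ℕ) : Cardinal) * packingNumber F := by
  rcases lt_or_ge (packingNumber F) ℵ₀ with h | h
  · obtain ⟨n, hn⟩ := Cardinal.lt_aleph0.1 h
    obtain ⟨T, hT, hTcard⟩ := exists_transversal_of_packingNumber_eq_nat hd hI hF hn
    exact ⟨T, hT, hn ▸ hTcard⟩
  · obtain ⟨T, hT, hTcard⟩ := exists_transversal_of_aleph0_le hI hF h
    refine ⟨T, hT, hTcard.trans ?_⟩
    have h1 : d < d ^ 2 := by nlinarith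
    have h2 : (1 : Cardinal) ≤ ((d ^ 2 - d : ℕ) : Cardinal) := by
      exact_mod_cast Nat.sub_pos_of_lt h1
    calc packingNumber F = 1 * packingNumber F := (one_mul _).symm
      _ ≤ _ := mul_le_mul_left h2 _
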